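/- Let $p$ be a known number of components, let $K\subset\mathbb R$ be compact, let $\Theta=(K\times K\times[0,\pi]\times[0,\pi])^p\subset\mathbb R^{4p}$, and let $\theta_0=(A_1^0,B_1^0,\lambda_1^0,\mu_1^0,\dots,A_p^0,B_p^0,\lambda_p^0,\mu_p^0)$ be an interior point of $\Theta$. Assume that the model has $p$ genuine components: $(A_k^0,B_k^0)\neq(0,0)$ for every $k$, and $(\lambda_j^0,\mu_j^0)\neq(\lambda_k^0,\mu_k^0)$ for $j\ne k$. One observes $$y(t,s)=\sum_{k=1}^p\Big(A_k^0\cos(\lambda_k^0t+\mu_k^0s)+B_k^0\sin(\lambda_k^0t+\mu_k^0s)\Big)+\epsilon(t,s),\qquad 1\le t\le T,\ 1\le s\le S,$$ where the $\epsilon(t,s)$, $t,s\ge1$, are i.i.d. real random variables with distribution function $G$ and continuous probability density $g$ such that $0$ is the unique median of $G$ (that is, $G(x)=\tfrac12$ if and only if $x=0$), $g$ is differentiable everywhere with bounded derivative $g'$, and $\mathbb E[\epsilon(t,s)^2]<\infty$. For $T,S\ge1$ let the least absolute deviation (LAD) estimator $\hat\theta_{T,S}$ be any minimizer over $\theta=(A_1,B_1,\lambda_1,\mu_1,\dots,A_p,B_p,\lambda_p,\mu_p)\in\Theta$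 of $$Q_{T,S}(\theta)=\frac1{TS}\sum_{t=1}^T\sum_{s=1}^S\Big|y(t,s)-\sum_{k=1}^p\big(A_k\cos(\lambda_kt+\mu_ks)+B_k\sin(\lambda_kt+\mu_ks)\big)\Big|.$$ Then $\hat\theta_{T,S}$ is strongly consistent for $\theta_0$, up to the labelling of the components: almost surely there are permutations $\sigma_{T,S}$ of $\{1,\dots,p\}$ such that the vector obtained from $\hat\theta_{T,S}$ by listing its $p$ quadruples $(\hat A_k,\hat B_k,\hat\lambda_k,\hat\mu_k)$ in the order $\sigma_{T,S}(1),\dots,\sigma_{T,S}(p)$ converges to $\theta_0$ as $\min\{T,S\}\to\infty$. In particular, for $p=1$, $\hat\theta_{T,S}\to\theta_0$ almost surely. -/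

import Mathlib

open MeasureTheory ProbabilityTheory Filter Topology

namespace LAD2D

noncomputable section

/-- The space of parameter vectors `(A₁, B₁, λ₁, μ₁, …, A_p, B_p, λ_p, μ_p)`, i.e. `ℝ^{4p}` (with its
usual topology), grouped as one quadruple `(A_k, B_k, λ_k, μ_k)` per component. -/
abbrev Param (p : ℕ) : Type := Fin p → ℝ × ℝ × ℝ × ℝ

namespace Param

variable {p : ℕ}

/-- The cosine amplitude `A_k`. -/
def A (θ : Param p) (k : Fin p) : ℝ := (θ k).1

/-- The sine amplitude `B_k`. -/
def B (θ : Param p) (k : Fin p) : ℝ := (θ k).2.1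

/-- The first frequency `λ_k`. -/
def freq₁ (θ : Param p) (k : Fin p) : ℝ := (θ k).2.2.1

/-- The second frequency `μ_k`. -/
def freq₂ (θ : Param p) (k : Fin p) : ℝ := (θ k).2.2.2

end Param

/-- The deterministic part
`∑ₖ (A_k cos(λ_k t + μ_k s) + B_k sin(λ_k t + μ_k s))` of the model. -/
def signal {p : ℕ} (θ : Param p) (t s : ℕ) : ℝ :=
  ∑ k : Fin p,
    (θ.A k * Real.cos (θ.freq₁ k * t + θ.freq₂ k * s)
      + θ.B k * Real.sin (θ.freq₁ k * t + θ.freq₂ k * s))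

/-- The LAD objective function
`Q_{T,S}(θ) = (1 / TS) ∑_{t=1}^T ∑_{s=1}^S |y(t,s) - signal θ t s|`, for `T, S ≥ 1`. -/
def objective {p : ℕ} (y : ℕ → ℕ → ℝ) (T S : ℕ) (θ : Param p) : ℝ :=
  1 / ((T : ℝ) * (S : ℝ)) *
    ∑ t ∈ Finset.Icc 1 T, ∑ s ∈ Finset.Icc 1 S, |y t s - signal θ t s|

/-- The parameter space `Θ = (K × K × [0,π] × [0,π])^p`. -/
def paramSpace (p : ℕ) (K : Set ℝ) : Set (Param p) :=
  Set.univ.pi fun _ : Fin p =>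
    K ×ˢ (K ×ˢ (Set.Icc 0 Real.pi ×ˢ Set.Icc 0 Real.pi))

/-- The model has `p` genuine components: no component vanishes identically, and distinct
components have distinct frequency pairs. -/
def HasGenuineComponents {p : ℕ} (θ : Param p) : Prop :=
  (∀ k, θ.A k ≠ 0 ∨ θ.B k ≠ 0) ∧
    ∀ j k, j ≠ k → (θ.freq₁ j, θ.freq₂ j) ≠ (θ.freq₁ k, θ.freq₂ k)

/-- The assumptions on the noise `ε(t,s)`, `t, s ≥ 1` (the values at `t = 0` or `s = 0` are
irrelevant): i.i.d. with distribution function `G` and continuous density `g`, the median `0` of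
`G` is unique, `g` is differentiable with bounded derivative, and the second moment is finite. -/
structure NoiseAssumption {Ω : Type*} [MeasurableSpace Ω] (P : Measure Ω)
    (ε : ℕ → ℕ → Ω → ℝ) (G g : ℝ → ℝ) : Prop where
  measurable : ∀ t s, 1 ≤ t → 1 ≤ s → Measurable (ε t s)
  indep : iIndepFun (fun i : ℕ × ℕ => ε (i.1 + 1) (i.2 + 1)) P
  distribution : ∀ t s, 1 ≤ t → 1 ≤ s → ∀ x, P.real {ω | ε t s ω ≤ x} = G x
  density_nonneg : ∀ x, 0 ≤ g x
  density : ∀ t s, 1 ≤ t → 1 ≤ s →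
    P.map (ε t s) = volume.withDensity fun x => ENNReal.ofReal (g x)
  density_continuous : Continuous g
  median : ∀ x, G x = 1 / 2 ↔ x = 0
  density_differentiable : Differentiable ℝ g
  density_deriv_bounded : ∃ C : ℝ, ∀ x, |deriv g x| ≤ C
  second_moment : ∀ t s, 1 ≤ t → 1 ≤ s → Integrable (fun ω => ε t s ω ^ 2) P

/-- `θhat T S ω` is, for all `T, S ≥ 1` and every outcome `ω`, a minimizer over `Θ` of the LAD
objective function of the observations `y(t,s)(ω)`, `1 ≤ t ≤ T`, `1 ≤ s ≤ S`. The minimizer need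
not be unique; any choice is allowed. -/
def IsLADEstimator {Ω : Type*} {p : ℕ} (Θ : Set (Param p)) (y : ℕ → ℕ → Ω → ℝ)
    (θhat : ℕ → ℕ → Ω → Param p) : Prop :=
  ∀ T S, 1 ≤ T → 1 ≤ S → ∀ ω,
    θhat T S ω ∈ Θ ∧
      ∀ θ ∈ Θ, objective (fun t s => y t s ω) T S (θhat T S ω)
        ≤ objective (fun t s => y t s ω) T S θ

end

end LAD2D

/-
Write `d = signal θ₀ - signal θ`. Then `Q(θ) - Q(θ₀)` is the grid mean of the gains
`|ε + d| - |ε|`. For fixed `θ`, Hoeffding's inequality makes its deviation from its expectation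
exponentially unlikely in `T S`; since the gains are Lipschitz in `θ` with constant `O(T S)`, a net
of polynomial size covers a ball of parameters, and Borel–Cantelli gives almost surely a uniform law
of large numbers. Uniqueness of the median bounds the expected gain below by `κ (|d| - τ)`, so the
grid mean of `|d|` tends to `0` at the minimizers. Multiplying `d` by the conjugate wave at a
frequency pair and averaging isolates the complex amplitude of the component at that frequency, so
that every limit point of the minimizers has the components of `θ₀`, up to order.
-/

namespace LAD2D

section PowMean

open scoped BigOperators ComplexConjugate

/-- The mean `T⁻¹ ∑_{t=1}^T z ^ t` of the first `T` powers of `z`, for `T ≥ 1`. For `z = e^{iα}` it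
measures how far the frequency `α` is from `2πℤ`, on the scale `1 / T`. -/
noncomputable def powMean (T : ℕ) (z : ℂ) : ℂ := 𝔼 t ∈ Finset.Icc 1 T, z ^ t

lemma natCast_mul_powMean (T : ℕ) (z : ℂ) :
    T * powMean T z = ∑ t ∈ Finset.Icc 1 T, z ^ t := by
  have h := Finset.card_mul_expect (Finset.Icc 1 T) fun t => z ^ t
  rwa [Nat.card_Icc, Nat.add_sub_cancel] at h

lemma norm_powMean_le_one (T : ℕ) {z : ℂ} (hz : ‖z‖ ≤ 1) : ‖powMean T z‖ ≤ 1 := by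
  rcases T.eq_zero_or_pos with rfl | hT
  · simp [powMean]
  · refine (RCLike.norm_expect_le (K := ℂ)).trans
      (Finset.expect_le (Finset.nonempty_Icc.2 hT) fun t _ => ?_)
    rw [norm_pow]
    exact pow_le_one₀ (norm_nonneg z) hz

lemma powMean_one {T : ℕ} (hT : 1 ≤ T) : powMean T 1 = 1 := by
  simp [powMean, Finset.expect_const (Finset.nonempty_Icc.2 hT)]

lemma norm_powMean_mul_sub_one_le (T : ℕ) {z : ℂ} (hz : ‖z‖ ≤ 1) :
    ‖powMean T z * (z - 1)‖ ≤ 2 / T := by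
  rcases T.eq_zero_or_pos with rfl | hT
  · simp [powMean]
  have hsum : T * (powMean T z * (z - 1)) = z ^ (T + 1) - z ^ 1 := by
    rw [← mul_assoc, natCast_mul_powMean, ← Finset.Ico_succ_right_eq_Icc]
    exact geom_sum_Ico_mul z (by simp)
  rw [le_div_iff₀' (by exact_mod_cast hT)]
  calc T * ‖powMean T z * (z - 1)‖ = ‖z ^ (T + 1) - z ^ 1‖ := by
        rw [← hsum, norm_mul (T : ℂ), Complex.norm_natCast]
    _ ≤ ‖z ^ (T + 1)‖ + ‖z ^ 1‖ := norm_sub_le _ _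
    _ ≤ 1 + 1 := by
        rw [norm_pow, norm_pow]
        exact add_le_add (pow_le_one₀ (norm_nonneg z) hz) (pow_le_one₀ (norm_nonneg z) hz)
    _ = 2 := by norm_num

lemma tendsto_powMean_zero {ι : Type*} {l : Filter ι} {T : ι → ℕ} (hT : Tendsto T l atTop)
    {z : ι → ℂ} (hz : ∀ i, ‖z i‖ ≤ 1) {a : ℂ} (hza : Tendsto z l (𝓝 a)) (ha : a ≠ 1) :
    Tendsto (fun i => powMean (T i) (z i)) l (𝓝 0) := by
  have hnum : Tendsto (fun i => powMean (T i) (z i) * (z i - 1)) l (𝓝 0) :=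
    squeeze_zero_norm (fun i => norm_powMean_mul_sub_one_le (T i) (hz i))
      ((tendsto_natCast_atTop_atTop.comp hT).const_div_atTop 2)
  have hden : Tendsto (fun i => z i - 1) l (𝓝 (a - 1)) := hza.sub_const 1
  have hquot := hnum.div hden (sub_ne_zero.2 ha)
  rw [zero_div] at hquot
  refine hquot.congr' ?_
  filter_upwards [hden.eventually_ne (sub_ne_zero.2 ha)] with i hi
  exact mul_div_cancel_right₀ _ hi

lemma sum_norm_pow_sub_sq (T : ℕ) {z w : ℂ} (hz : ‖z‖ = 1) (hw : ‖w‖ = 1) :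
    ∑ t ∈ Finset.Icc 1 T, ‖z ^ t - w‖ ^ 2 = 2 * T * (1 - (powMean T z * conj w).re) := by
  have hterm : ∀ t, ‖z ^ t - w‖ ^ 2 = 2 - 2 * (z ^ t * conj w).re := fun t => by
    rw [← Complex.normSq_eq_norm_sq, Complex.normSq_sub, Complex.normSq_eq_norm_sq,
      Complex.normSq_eq_norm_sq, norm_pow, hz, hw]
    ring
  have hre : ∑ t ∈ Finset.Icc 1 T, (z ^ t * conj w).re = T * (powMean T z * conj w).re := by
    rw [← Complex.re_sum, ← Finset.sum_mul, ← natCast_mul_powMean, mul_assoc,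
      ← Complex.ofReal_natCast, Complex.re_ofReal_mul]
  simp_rw [hterm]
  rw [Finset.sum_sub_distrib, ← Finset.mul_sum, hre, Finset.sum_const, Nat.card_Icc, nsmul_eq_mul,
    Nat.add_sub_cancel]
  ring

/- If most powers of `z` are close to `w`, then so is `z ^ (2 * t)` for most `t`, but it is also
close to `w ^ 2`. -/
lemma norm_sub_one_sq_le_of_pow {z w : ℂ} (hz : ‖z‖ = 1) (hw : ‖w‖ = 1) (t : ℕ) :
    ‖w - 1‖ ^ 2 ≤ 8 * ‖z ^ t - w‖ ^ 2 + 2 * ‖z ^ (2 * t) - w‖ ^ 2 := by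
  have hfactor : w * (w - 1) = (z ^ (2 * t) - w) - (z ^ t + w) * (z ^ t - w) := by ring
  have hbound : ‖w - 1‖ ≤ ‖z ^ (2 * t) - w‖ + 2 * ‖z ^ t - w‖ := by
    calc ‖w - 1‖ = ‖w * (w - 1)‖ := by rw [norm_mul, hw, one_mul]
      _ ≤ ‖z ^ (2 * t) - w‖ + ‖z ^ t + w‖ * ‖z ^ t - w‖ := by
          rw [hfactor, ← norm_mul]
          exact norm_sub_le _ _
      _ ≤ ‖z ^ (2 * t) - w‖ + 2 * ‖z ^ t - w‖ := by
          gcongr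
          refine (norm_add_le _ _).trans ?_
          rw [norm_pow, hz, hw]
          norm_num
  calc ‖w - 1‖ ^ 2 ≤ (‖z ^ (2 * t) - w‖ + 2 * ‖z ^ t - w‖) ^ 2 := by gcongr
    _ ≤ 8 * ‖z ^ t - w‖ ^ 2 + 2 * ‖z ^ (2 * t) - w‖ ^ 2 := by
        linarith [sq_nonneg (‖z ^ (2 * t) - w‖ - 2 * ‖z ^ t - w‖)]

lemma norm_sub_one_sq_le {T : ℕ} (hT : 2 ≤ T) {z w : ℂ} (hz : ‖z‖ = 1) (hw : ‖w‖ = 1) :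
    ‖w - 1‖ ^ 2 ≤ 60 * (1 - (powMean T z * conj w).re) := by
  set total := ∑ t ∈ Finset.Icc 1 T, ‖z ^ t - w‖ ^ 2 with htotal
  have hlow : ∑ t ∈ Finset.Icc 1 (T / 2), ‖z ^ t - w‖ ^ 2 ≤ total :=
    Finset.sum_le_sum_of_subset_of_nonneg (Finset.Icc_subset_Icc le_rfl (Nat.div_le_self _ _))
      fun _ _ _ => sq_nonneg _
  have heven : ∑ t ∈ Finset.Icc 1 (T / 2), ‖z ^ (2 * t) - w‖ ^ 2 ≤ total := by
    rw [← Finset.sum_image (f := fun t => ‖z ^ t - w‖ ^ 2) (g := fun t => 2 * t)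
      fun a _ b _ h => Nat.eq_of_mul_eq_mul_left two_pos h]
    refine Finset.sum_le_sum_of_subset_of_nonneg (fun t ht => ?_) fun _ _ _ => sq_nonneg _
    simp only [Finset.mem_image, Finset.mem_Icc] at ht ⊢
    omega
  have hhalf : (T / 2 : ℕ) * ‖w - 1‖ ^ 2 ≤ 10 * total := by
    calc (T / 2 : ℕ) * ‖w - 1‖ ^ 2 = ∑ _t ∈ Finset.Icc 1 (T / 2), ‖w - 1‖ ^ 2 := by simp
      _ ≤ ∑ t ∈ Finset.Icc 1 (T / 2), (8 * ‖z ^ t - w‖ ^ 2 + 2 * ‖z ^ (2 * t) - w‖ ^ 2) :=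
          Finset.sum_le_sum fun t _ => norm_sub_one_sq_le_of_pow hz hw t
      _ ≤ 10 * total := by
          rw [Finset.sum_add_distrib, ← Finset.mul_sum, ← Finset.mul_sum]
          linarith
  rw [htotal, sum_norm_pow_sub_sq T hz hw] at hhalf
  have hT3 : (T : ℝ) ≤ 3 * (T / 2 : ℕ) := by exact_mod_cast (by omega : T ≤ 3 * (T / 2))
  have hT0 : (0 : ℝ) < T := by exact_mod_cast two_pos.trans_le hT
  refine le_of_mul_le_mul_left ?_ hT0
  nlinarith [mul_le_mul_of_nonneg_right hT3 (sq_nonneg ‖w - 1‖)]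

lemma norm_powMean_sub_one_le {T : ℕ} (hT : 2 ≤ T) {z : ℂ} (hz : ‖z‖ = 1) :
    ‖powMean T z - 1‖ ≤ (1 - ‖powMean T z‖) + √(60 * (1 - ‖powMean T z‖)) := by
  set m := powMean T z
  have hm : ‖m‖ ≤ 1 := norm_powMean_le_one T hz.le
  obtain ⟨w, hw, hmw⟩ : ∃ w : ℂ, ‖w‖ = 1 ∧ m = ‖m‖ * w :=
    ⟨Complex.exp (m.arg * Complex.I), Complex.norm_exp_ofReal_mul_I _,
      (Complex.norm_mul_exp_arg_mul_I m).symm⟩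
  have hre : (m * conj w).re = ‖m‖ := by
    rw [hmw, mul_assoc, Complex.mul_conj, Complex.normSq_eq_norm_sq, hw]
    simp [hw]
  have hmw' : ‖m - w‖ = 1 - ‖m‖ := by
    calc ‖m - w‖ = ‖((‖m‖ - 1 : ℝ) : ℂ) * w‖ := by
          rw [Complex.ofReal_sub, sub_mul, ← hmw, Complex.ofReal_one, one_mul]
      _ = 1 - ‖m‖ := by
          rw [norm_mul, hw, mul_one, Complex.norm_real, Real.norm_of_nonpos (by linarith), neg_sub]
  have hw1 : ‖w - 1‖ ≤ √(60 * (1 - ‖m‖)) := by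
    rw [← hre]
    exact Real.le_sqrt_of_sq_le (norm_sub_one_sq_le hT hz hw)
  calc ‖m - 1‖ ≤ ‖m - w‖ + ‖w - 1‖ := norm_sub_le_norm_sub_add_norm_sub _ _ _
    _ ≤ _ := add_le_add hmw'.le hw1

lemma tendsto_powMean_one_of_norm {ι : Type*} {l : Filter ι} {T : ι → ℕ} (hT : Tendsto T l atTop)
    {z : ι → ℂ} (hz : ∀ i, ‖z i‖ = 1)
    (h : Tendsto (fun i => ‖powMean (T i) (z i)‖) l (𝓝 1)) :
    Tendsto (fun i => powMean (T i) (z i)) l (𝓝 1) := by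
  have hgap : Tendsto (fun i => 1 - ‖powMean (T i) (z i)‖) l (𝓝 0) := by
    simpa only [sub_self] using h.const_sub 1
  have hbound := hgap.add (hgap.const_mul 60).sqrt
  rw [mul_zero, Real.sqrt_zero, add_zero] at hbound
  refine tendsto_iff_norm_sub_tendsto_zero.2 (squeeze_zero' (.of_forall fun _ => norm_nonneg _) ?_
    hbound)
  filter_upwards [hT.eventually_ge_atTop 2] with i hi
  exact norm_powMean_sub_one_le hi (hz i)

end PowMean

section Demodulation

open scoped BigOperators ComplexConjugate

/-- The plane wave `(t, s) ↦ e^{i(ν₁t + ν₂s)}` on the observation grid, for a frequency pair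
`ν = (ν₁, ν₂)`. -/
noncomputable def wave (ν : ℝ × ℝ) (i : ℕ × ℕ) : Circle :=
  Circle.exp ν.1 ^ i.1 * Circle.exp ν.2 ^ i.2

lemma wave_neg (ν : ℝ × ℝ) (i : ℕ × ℕ) : wave (-ν) i = (wave ν i)⁻¹ := by
  simp only [wave, Prod.fst_neg, Prod.snd_neg, Circle.exp_neg, inv_pow, mul_inv]

lemma wave_add (ν ν' : ℝ × ℝ) (i : ℕ × ℕ) : wave (ν + ν') i = wave ν i * wave ν' i := by
  simp only [wave, Prod.fst_add, Prod.snd_add, Circle.exp_add, mul_pow, mul_mul_mul_comm]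

lemma wave_eq_exp (ν : ℝ × ℝ) (i : ℕ × ℕ) :
    wave ν i = Circle.exp (ν.1 * i.1 + ν.2 * i.2) := by
  rw [wave, Circle.exp_add, mul_comm ν.1, mul_comm ν.2, Circle.exp_natCast_mul,
    Circle.exp_natCast_mul]

lemma wave_eq_one_iff {ν : ℝ × ℝ} : wave ν = 1 ↔ Circle.exp ν.1 = 1 ∧ Circle.exp ν.2 = 1 := by
  refine ⟨fun h => ⟨?_, ?_⟩, fun h => ?_⟩
  · simpa [wave] using congrFun h (1, 0)
  · simpa [wave] using congrFun h (0, 1)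
  · funext i
    simp [wave, h]

/-- The mean over the grid `1 ≤ t ≤ T`, `1 ≤ s ≤ S`, where `n = (T, S)`, of the plane wave with
frequency pair `ν`. -/
noncomputable def waveMean (n : ℕ × ℕ) (ν : ℝ × ℝ) : ℂ := 𝔼 i ∈ Finset.Icc 1 n, (wave ν i : ℂ)

lemma waveMean_eq_mul (n : ℕ × ℕ) (ν : ℝ × ℝ) :
    waveMean n ν = powMean n.1 (Circle.exp ν.1) * powMean n.2 (Circle.exp ν.2) := by
  simp only [waveMean, wave, powMean, Circle.coe_mul, Circle.coe_pow, Finset.Icc_prod_def,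
    Finset.expect_mul_expect, Finset.expect_product, Prod.fst_one, Prod.snd_one]

lemma norm_waveMean_le_one (n : ℕ × ℕ) (ν : ℝ × ℝ) : ‖waveMean n ν‖ ≤ 1 := by
  rw [waveMean_eq_mul, norm_mul]
  exact mul_le_one₀ (norm_powMean_le_one _ (Circle.norm_coe _).le) (norm_nonneg _)
    (norm_powMean_le_one _ (Circle.norm_coe _).le)

lemma waveMean_zero {n : ℕ × ℕ} (hn : 1 ≤ n) : waveMean n 0 = 1 := by
  simp [waveMean_eq_mul, powMean_one hn.1, powMean_one hn.2]

/-- The single component `a cos(λt + μs) + b sin(λt + μs)` of the model, for `q = (a, b, λ, μ)`. -/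
noncomputable def component (q : ℝ × ℝ × ℝ × ℝ) (i : ℕ × ℕ) : ℝ :=
  q.1 * Real.cos (q.2.2.1 * i.1 + q.2.2.2 * i.2) + q.2.1 * Real.sin (q.2.2.1 * i.1 + q.2.2.2 * i.2)

lemma signal_eq_sum_component {p : ℕ} (θ : Param p) (i : ℕ × ℕ) :
    signal θ i.1 i.2 = ∑ k, component (θ k) i := rfl

/-- The complex amplitude `a - ib` of the component `q = (a, b, λ, μ)`: the component is the real
part of `(a - ib) e^{i(λt + μs)}`. -/
noncomputable def amplitude (q : ℝ × ℝ × ℝ × ℝ) : ℂ := q.1 - q.2.1 * Complex.I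

lemma continuous_amplitude : Continuous amplitude := by
  unfold amplitude
  fun_prop

lemma amplitude_re (q : ℝ × ℝ × ℝ × ℝ) : (amplitude q).re = q.1 := by simp [amplitude]

lemma amplitude_im (q : ℝ × ℝ × ℝ × ℝ) : (amplitude q).im = -q.2.1 := by simp [amplitude]

lemma amplitude_ne_zero {q : ℝ × ℝ × ℝ × ℝ} (h : q.1 ≠ 0 ∨ q.2.1 ≠ 0) : amplitude q ≠ 0 := by
  rw [Ne, Complex.ext_iff, amplitude_re, amplitude_im, Complex.zero_re, Complex.zero_im,
    neg_eq_zero, not_and_or]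
  exact h

lemma eq_of_amplitude_eq {q r : ℝ × ℝ × ℝ × ℝ} (h : amplitude q = amplitude r)
    (hfreq : q.2.2 = r.2.2) : q = r := by
  rw [Complex.ext_iff, amplitude_re, amplitude_re, amplitude_im, amplitude_im, neg_inj] at h
  exact Prod.ext h.1 (Prod.ext h.2 hfreq)

lemma two_mul_component (q : ℝ × ℝ × ℝ × ℝ) (i : ℕ × ℕ) :
    (2 * component q i : ℂ)
      = amplitude q * wave q.2.2 i + conj (amplitude q) * wave (-q.2.2) i := by
  rw [wave_neg, Circle.coe_inv_eq_conj, ← map_mul, Complex.add_conj, wave_eq_exp, Circle.coe_exp,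
    Complex.mul_re, amplitude_re, amplitude_im, Complex.exp_ofReal_mul_I_re,
    Complex.exp_ofReal_mul_I_im, component, neg_mul, sub_neg_eq_add]
  push_cast
  ring

/-- The demodulation of `f` at the frequency pair `ν`: twice the mean of `f(t,s) e^{-i(ν₁t + ν₂s)}`
over the grid `1 ≤ t ≤ T`, `1 ≤ s ≤ S`, where `n = (T, S)`. The factor `2` makes it return the
complex amplitude of a component with frequency pair `ν`, up to a vanishing error. -/
noncomputable def demod (n : ℕ × ℕ) (ν : ℝ × ℝ) (f : ℕ × ℕ → ℝ) : ℂ :=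
  2 * 𝔼 i ∈ Finset.Icc 1 n, (f i : ℂ) * wave (-ν) i

lemma demod_sub (n : ℕ × ℕ) (ν : ℝ × ℝ) (f g : ℕ × ℕ → ℝ) :
    demod n ν (fun i => f i - g i) = demod n ν f - demod n ν g := by
  simp only [demod, Complex.ofReal_sub, sub_mul, Finset.expect_sub_distrib, mul_sub]

lemma demod_sum {κ : Type*} (n : ℕ × ℕ) (ν : ℝ × ℝ) (u : Finset κ) (f : κ → ℕ × ℕ → ℝ) :
    demod n ν (fun i => ∑ k ∈ u, f k i) = ∑ k ∈ u, demod n ν (f k) := by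
  simp only [demod, Complex.ofReal_sum, Finset.sum_mul, ← Finset.mul_sum, Finset.expect_sum_comm]

lemma norm_demod_le (n : ℕ × ℕ) (ν : ℝ × ℝ) (f : ℕ × ℕ → ℝ) :
    ‖demod n ν f‖ ≤ 2 * 𝔼 i ∈ Finset.Icc 1 n, |f i| := by
  rw [demod, norm_mul, Complex.norm_ofNat]
  gcongr
  refine (RCLike.norm_expect_le (K := ℂ)).trans_eq (Finset.expect_congr rfl fun i _ => ?_)
  rw [norm_mul, Circle.norm_coe, mul_one, Complex.norm_real, Real.norm_eq_abs]

lemma demod_component (n : ℕ × ℕ) (ν : ℝ × ℝ) (q : ℝ × ℝ × ℝ × ℝ) :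
    demod n ν (component q)
      = amplitude q * waveMean n (q.2.2 - ν) + conj (amplitude q) * waveMean n (-q.2.2 - ν) := by
  simp only [demod, waveMean, Finset.mul_expect, ← Finset.expect_add_distrib]
  refine Finset.expect_congr rfl fun i _ => ?_
  rw [← mul_assoc, two_mul_component, sub_eq_add_neg, sub_eq_add_neg, wave_add, wave_add,
    Circle.coe_mul, Circle.coe_mul]
  ring

lemma objective_eq_expect {p : ℕ} (y : ℕ → ℕ → ℝ) (n : ℕ × ℕ) (θ : Param p) :
    objective y n.1 n.2 θ = 𝔼 i ∈ Finset.Icc 1 n, |y i.1 i.2 - signal θ i.1 i.2| := by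
  rw [objective, Finset.expect_eq_sum_div_card, Finset.Icc_prod_def, Finset.sum_product,
    Finset.card_product, Nat.card_Icc, Nat.card_Icc, one_div_mul_eq_div]
  simp

end Demodulation

section Frequencies

open Real

/-- The square `[0, π]²` of admissible frequency pairs. -/
def freqSquare : Set (ℝ × ℝ) := Set.Icc 0 π ×ˢ Set.Icc 0 π

/-- The frequency pairs in `[0, π]²` other than its four corners, at which the sine wave vanishes
identically on `ℤ²`, so that the sine amplitude cannot be identified. -/
def regularFreq : Set (ℝ × ℝ) := {ν ∈ freqSquare | ν.1 ∈ Set.Ioo 0 π ∨ ν.2 ∈ Set.Ioo 0 π}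

lemma eq_zero_of_circleExp_eq_one {x : ℝ} (hx : |x| < 2 * π) (h : Circle.exp x = 1) : x = 0 := by
  obtain ⟨n, rfl⟩ := Circle.exp_eq_one.1 h
  rw [abs_mul, abs_of_pos two_pi_pos, mul_lt_iff_lt_one_left two_pi_pos] at hx
  have hn : n = 0 := Int.abs_lt_one_iff.1 (by exact_mod_cast hx)
  rw [hn, Int.cast_zero, zero_mul]

lemma wave_sub_ne_one {ν ν' : ℝ × ℝ} (hν : ν ∈ freqSquare) (hν' : ν' ∈ freqSquare) (h : ν ≠ ν') :
    wave (ν - ν') ≠ 1 := by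
  have heq : ∀ {a b : ℝ}, a ∈ Set.Icc 0 π → b ∈ Set.Icc 0 π → Circle.exp (a - b) = 1 → a = b := by
    intro a b ha hb hab
    refine Circle.exp_injOn_Icc (by linarith [pi_pos]) ha hb ?_
    rwa [Circle.exp_sub, div_eq_one] at hab
  rw [Ne, wave_eq_one_iff]
  exact fun hw => h (Prod.ext (heq hν.1 hν'.1 hw.1) (heq hν.2 hν'.2 hw.2))

lemma wave_neg_sub_ne_one {ν ν' : ℝ × ℝ} (hν : ν ∈ freqSquare) (hν' : ν' ∈ regularFreq) :
    wave (-ν - ν') ≠ 1 := by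
  have hne : ∀ {a b : ℝ}, a ∈ Set.Icc 0 π → b ∈ Set.Ioo 0 π → Circle.exp (-a - b) ≠ 1 := by
    intro a b ha hb hab
    have hlt : |-a - b| < 2 * π := by
      rw [abs_lt]
      constructor <;> linarith [ha.1, ha.2, hb.1, hb.2]
    linarith [eq_zero_of_circleExp_eq_one hlt hab, ha.1, hb.1]
  rw [Ne, wave_eq_one_iff]
  rintro ⟨h₁, h₂⟩
  exact hν'.2.elim (fun h => hne hν.1 h h₁) (fun h => hne hν.2 h h₂)

end Frequencies

section Limits

open scoped ComplexConjugate

variable {ι : Type*} {l : Filter ι} {n : ι → ℕ × ℕ} {ν : ι → ℝ × ℝ} {ν₀ : ℝ × ℝ}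

lemma tendsto_waveMean_zero (hn : Tendsto n l atTop) (hν : Tendsto ν l (𝓝 ν₀))
    (h : wave ν₀ ≠ 1) : Tendsto (fun i => waveMean (n i) (ν i)) l (𝓝 0) := by
  rw [← prod_atTop_atTop_eq] at hn
  have hexp : ∀ {a : ι → ℝ} {a₀ : ℝ}, Tendsto a l (𝓝 a₀) →
      Tendsto (fun i => (Circle.exp (a i) : ℂ)) l (𝓝 (Circle.exp a₀)) := fun h =>
    ((continuous_subtype_val.comp Circle.exp.continuous).tendsto _).comp h
  have hfactor : ∀ {T : ι → ℕ} {a : ι → ℝ} {a₀ : ℝ}, Tendsto T l atTop → Tendsto a l (𝓝 a₀) →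
      Circle.exp a₀ ≠ 1 → Tendsto (fun i => ‖powMean (T i) (Circle.exp (a i))‖) l (𝓝 0) :=
    fun hT ha h => tendsto_zero_iff_norm_tendsto_zero.1 <| tendsto_powMean_zero hT
      (fun _ => (Circle.norm_coe _).le) (hexp ha) (by rwa [Ne, Circle.coe_eq_one])
  have hle : ∀ (T : ℕ) (a : ℝ), ‖powMean T (Circle.exp a)‖ ≤ 1 := fun T a =>
    norm_powMean_le_one T (Circle.norm_coe _).le
  simp only [waveMean_eq_mul]
  rw [Ne, wave_eq_one_iff, not_and_or] at h
  rcases h with h | h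
  · refine squeeze_zero_norm (fun i => ?_) (hfactor hn.fst hν.fst_nhds h)
    rw [norm_mul]
    exact mul_le_of_le_one_right (norm_nonneg _) (hle _ _)
  · refine squeeze_zero_norm (fun i => ?_) (hfactor hn.snd hν.snd_nhds h)
    rw [norm_mul]
    exact mul_le_of_le_one_left (norm_nonneg _) (hle _ _)

lemma tendsto_waveMean_one_of_norm (hn : Tendsto n l atTop)
    (h : Tendsto (fun i => ‖waveMean (n i) (ν i)‖) l (𝓝 1)) :
    Tendsto (fun i => waveMean (n i) (ν i)) l (𝓝 1) := by
  rw [← prod_atTop_atTop_eq] at hn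
  have hle : ∀ (T : ℕ) (a : ℝ), ‖powMean T (Circle.exp a)‖ ≤ 1 := fun T a =>
    norm_powMean_le_one T (Circle.norm_coe _).le
  simp only [waveMean_eq_mul, norm_mul] at h ⊢
  have h₁ := tendsto_powMean_one_of_norm hn.fst (fun i => Circle.norm_coe (Circle.exp (ν i).1))
    (tendsto_of_tendsto_of_tendsto_of_le_of_le h tendsto_const_nhds
      (fun i => mul_le_of_le_one_right (norm_nonneg _) (hle _ _)) fun i => hle _ _)
  have h₂ := tendsto_powMean_one_of_norm hn.snd (fun i => Circle.norm_coe (Circle.exp (ν i).2))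
    (tendsto_of_tendsto_of_tendsto_of_le_of_le h tendsto_const_nhds
      (fun i => mul_le_of_le_one_left (norm_nonneg _) (hle _ _)) fun i => hle _ _)
  simpa only [mul_one] using h₁.mul h₂

section Component

variable {q : ι → ℝ × ℝ × ℝ × ℝ} {q₀ : ℝ × ℝ × ℝ × ℝ}

lemma tendsto_demod_component_sub (hn : Tendsto n l atTop) (hq : Tendsto q l (𝓝 q₀))
    (hν : Tendsto ν l (𝓝 ν₀)) (hq₀ : q₀.2.2 ∈ freqSquare) (hν₀ : ν₀ ∈ regularFreq) :
    Tendsto (fun i => demod (n i) (ν i) (component (q i))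
      - amplitude (q i) * waveMean (n i) ((q i).2.2 - ν i)) l (𝓝 0) := by
  have hmean : Tendsto (fun i => waveMean (n i) (-(q i).2.2 - ν i)) l (𝓝 0) :=
    tendsto_waveMean_zero hn (hq.snd_nhds.snd_nhds.neg.sub hν) (wave_neg_sub_ne_one hq₀ hν₀)
  have hamp : Tendsto (fun i => conj (amplitude (q i))) l (𝓝 (conj (amplitude q₀))) :=
    ((Complex.continuous_conj.comp continuous_amplitude).tendsto q₀).comp hq
  simpa only [demod_component, add_sub_cancel_left, mul_zero] using hamp.mul hmean

lemma tendsto_demod_component_zero (hn : Tendsto n l atTop) (hq : Tendsto q l (𝓝 q₀))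
    (hν : Tendsto ν l (𝓝 ν₀)) (hq₀ : q₀.2.2 ∈ freqSquare) (hν₀ : ν₀ ∈ regularFreq)
    (hne : q₀.2.2 ≠ ν₀) : Tendsto (fun i => demod (n i) (ν i) (component (q i))) l (𝓝 0) := by
  have hmean : Tendsto (fun i => waveMean (n i) ((q i).2.2 - ν i)) l (𝓝 0) :=
    tendsto_waveMean_zero hn (hq.snd_nhds.snd_nhds.sub hν) (wave_sub_ne_one hq₀ hν₀.1 hne)
  have hamp : Tendsto (fun i => amplitude (q i)) l (𝓝 (amplitude q₀)) :=
    (continuous_amplitude.tendsto q₀).comp hq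
  simpa only [sub_add_cancel, mul_zero, add_zero] using
    (tendsto_demod_component_sub hn hq hν hq₀ hν₀).add (hamp.mul hmean)

end Component

/-- The demodulation of the noiseless signal with parameter `θ`. -/
noncomputable def spectrum {p : ℕ} (n : ℕ × ℕ) (ν : ℝ × ℝ) (θ : Param p) : ℂ :=
  demod n ν fun i => signal θ i.1 i.2

lemma spectrum_eq_sum {p : ℕ} (n : ℕ × ℕ) (ν : ℝ × ℝ) (θ : Param p) :
    spectrum n ν θ = ∑ k, demod n ν (component (θ k)) := by
  simp only [spectrum, signal_eq_sum_component, demod_sum]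

variable {p : ℕ} {θ θ' : ι → Param p} {τ : Param p}

lemma tendsto_spectrum_sub
    (h : Tendsto (fun i => objective (signal (θ' i)) (n i).1 (n i).2 (θ i)) l (𝓝 0))
    (ν : ι → ℝ × ℝ) :
    Tendsto (fun i => spectrum (n i) (ν i) (θ' i) - spectrum (n i) (ν i) (θ i)) l (𝓝 0) := by
  have hbound := h.const_mul 2
  rw [mul_zero] at hbound
  refine squeeze_zero_norm (fun i => ?_) hbound
  rw [objective_eq_expect, spectrum, spectrum, ← demod_sub]
  exact norm_demod_le _ _ _

lemma tendsto_spectrum_zero (hn : Tendsto n l atTop) (hθ : Tendsto θ l (𝓝 τ))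
    (hν : Tendsto ν l (𝓝 ν₀)) (hτ : ∀ k, (τ k).2.2 ∈ freqSquare) (hν₀ : ν₀ ∈ regularFreq)
    (hne : ∀ k, (τ k).2.2 ≠ ν₀) : Tendsto (fun i => spectrum (n i) (ν i) (θ i)) l (𝓝 0) := by
  simp only [spectrum_eq_sum]
  simpa only [Finset.sum_const_zero] using tendsto_finsetSum Finset.univ fun k _ =>
    tendsto_demod_component_zero hn (hθ.apply_nhds k) hν (hτ k) hν₀ (hne k)

lemma tendsto_spectrum_sub_amplitude_mul (hn : Tendsto n l atTop) (hθ : Tendsto θ l (𝓝 τ))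
    (hν : Tendsto ν l (𝓝 ν₀)) (hτ : ∀ k, (τ k).2.2 ∈ freqSquare) (hν₀ : ν₀ ∈ regularFreq)
    {m : Fin p} (hne : ∀ k, k ≠ m → (τ k).2.2 ≠ ν₀) :
    Tendsto (fun i => spectrum (n i) (ν i) (θ i)
      - amplitude (θ i m) * waveMean (n i) ((θ i m).2.2 - ν i)) l (𝓝 0) := by
  have hothers : Tendsto (fun i => ∑ k ∈ Finset.univ.erase m,
      demod (n i) (ν i) (component (θ i k))) l (𝓝 0) := by
    simpa only [Finset.sum_const_zero] using tendsto_finsetSum (Finset.univ.erase m) fun k hk =>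
      tendsto_demod_component_zero hn (hθ.apply_nhds k) hν (hτ k) hν₀
        (hne k (Finset.ne_of_mem_erase hk))
  have hsum := hothers.add
    (tendsto_demod_component_sub hn (hθ.apply_nhds m) hν (hτ m) hν₀)
  rw [add_zero] at hsum
  refine hsum.congr fun i => ?_
  rw [spectrum_eq_sum, ← Finset.sum_erase_add _ _ (Finset.mem_univ m), add_sub_assoc]

lemma tendsto_spectrum_self (hn : Tendsto n l atTop) (hθ : Tendsto θ l (𝓝 τ))
    (hτ : ∀ k, (τ k).2.2 ∈ freqSquare) {m : Fin p} (hm : (τ m).2.2 ∈ regularFreq)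
    (hne : ∀ k, k ≠ m → (τ k).2.2 ≠ (τ m).2.2) :
    Tendsto (fun i => spectrum (n i) (θ i m).2.2 (θ i)) l (𝓝 (amplitude (τ m))) := by
  have hθm := hθ.apply_nhds m
  have hsum := (tendsto_spectrum_sub_amplitude_mul hn hθ hθm.snd_nhds.snd_nhds hτ hm hne).add
    ((continuous_amplitude.tendsto (τ m)).comp hθm)
  rw [zero_add] at hsum
  refine hsum.congr' ?_
  filter_upwards [hn.eventually_ge_atTop 1] with i hi
  rw [sub_self, waveMean_zero hi, mul_one, Function.comp_apply, sub_add_cancel]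

end Limits

section Identifiability

variable {ι : Type*} {l : Filter ι} [l.NeBot] {n : ι → ℕ × ℕ} {p : ℕ}
  {θ : ι → Param p} {θ₀ τ : Param p}

lemma HasGenuineComponents.amplitude_ne_zero (h : HasGenuineComponents θ₀) (k : Fin p) :
    amplitude (θ₀ k) ≠ 0 :=
  LAD2D.amplitude_ne_zero (h.1 k)

lemma HasGenuineComponents.freq_ne (h : HasGenuineComponents θ₀) {j k : Fin p} (hjk : j ≠ k) :
    (θ₀ j).2.2 ≠ (θ₀ k).2.2 :=
  h.2 j k hjk

lemma exists_freq_eq (hn : Tendsto n l atTop) (hθ : Tendsto θ l (𝓝 τ))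
    (hτ : ∀ k, (τ k).2.2 ∈ freqSquare) (hcomp : HasGenuineComponents θ₀)
    (hθ₀ : ∀ k, (θ₀ k).2.2 ∈ regularFreq)
    (h : Tendsto (fun i => objective (signal θ₀) (n i).1 (n i).2 (θ i)) l (𝓝 0)) (j : Fin p) :
    ∃ k, (τ k).2.2 = (θ₀ j).2.2 := by
  by_contra! hne
  have htrue : Tendsto (fun i => spectrum (n i) (θ₀ j).2.2 θ₀) l (𝓝 (amplitude (θ₀ j))) :=
    tendsto_spectrum_self hn tendsto_const_nhds (fun k => (hθ₀ k).1) (hθ₀ j)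
      fun k hk => hcomp.freq_ne hk
  have hfit : Tendsto (fun i => spectrum (n i) (θ₀ j).2.2 (θ i)) l (𝓝 0) :=
    tendsto_spectrum_zero hn hθ tendsto_const_nhds hτ (hθ₀ j) hne
  have hzero := tendsto_nhds_unique (htrue.sub hfit) (tendsto_spectrum_sub h fun _ => (θ₀ j).2.2)
  exact hcomp.amplitude_ne_zero j (by rwa [sub_zero] at hzero)

/- The hypotheses are what demodulating at the true and at the fitted frequency pair gives. They
force `‖waveMean‖ → 1`, and a wave mean of modulus near `1` is itself near `1`. -/
lemma eq_of_mul_waveMean {a : ι → ℂ} {a₀ a₁ : ℂ} {ν : ι → ℝ × ℝ} (hn : Tendsto n l atTop)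
    (ha : Tendsto a l (𝓝 a₁)) (ha₀ : a₀ ≠ 0)
    (h₁ : Tendsto (fun i => a i * waveMean (n i) (ν i)) l (𝓝 a₀))
    (h₂ : Tendsto (fun i => a₀ * waveMean (n i) (-ν i)) l (𝓝 a₁)) : a₁ = a₀ := by
  have hle₁ : ‖a₀‖ ≤ ‖a₁‖ := le_of_tendsto_of_tendsto h₁.norm ha.norm <| .of_forall fun i => by
    simpa only [norm_mul] using
      mul_le_of_le_one_right (norm_nonneg (a i)) (norm_waveMean_le_one (n i) (ν i))
  have hle₂ : ‖a₁‖ ≤ ‖a₀‖ := le_of_tendsto h₂.norm <| .of_forall fun i => by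
    simpa only [norm_mul] using
      mul_le_of_le_one_right (norm_nonneg a₀) (norm_waveMean_le_one (n i) (-ν i))
  have hnorm : Tendsto (fun i => ‖waveMean (n i) (-ν i)‖) l (𝓝 1) := by
    have hdiv := h₂.norm.div_const ‖a₀‖
    simpa only [norm_mul, mul_div_cancel_left₀ _ (norm_ne_zero_iff.2 ha₀), hle₂.antisymm hle₁,
      div_self (norm_ne_zero_iff.2 ha₀)] using hdiv
  have hone := (tendsto_waveMean_one_of_norm hn hnorm).const_mul a₀
  rw [mul_one] at hone
  exact tendsto_nhds_unique h₂ hone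

lemma amplitude_eq_of_freq_eq (hn : Tendsto n l atTop) (hθ : Tendsto θ l (𝓝 τ))
    (hτ : ∀ k, (τ k).2.2 ∈ freqSquare) (hcomp : HasGenuineComponents θ₀)
    (hθ₀ : ∀ k, (θ₀ k).2.2 ∈ regularFreq)
    (h : Tendsto (fun i => objective (signal θ₀) (n i).1 (n i).2 (θ i)) l (𝓝 0)) {j m : Fin p}
    (hm : (τ m).2.2 = (θ₀ j).2.2) (hisol : ∀ k, k ≠ m → (τ k).2.2 ≠ (θ₀ j).2.2) :
    amplitude (τ m) = amplitude (θ₀ j) := by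
  have hθm := hθ.apply_nhds m
  have hνm : Tendsto (fun i => (θ i m).2.2) l (𝓝 (θ₀ j).2.2) := hm ▸ hθm.snd_nhds.snd_nhds
  have hself := tendsto_spectrum_self hn (tendsto_const_nhds (x := θ₀)) (fun k => (hθ₀ k).1)
    (hθ₀ j) fun k hk => hcomp.freq_ne hk
  have hself' := tendsto_spectrum_self hn hθ hτ (hm ▸ hθ₀ j) (hm ▸ hisol)
  have hfit := tendsto_spectrum_sub_amplitude_mul hn hθ (tendsto_const_nhds (x := (θ₀ j).2.2)) hτ
    (hθ₀ j) hisol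
  have htrue := tendsto_spectrum_sub_amplitude_mul hn (tendsto_const_nhds (x := θ₀)) hνm
    (fun k => (hθ₀ k).1) (hθ₀ j) fun k hk => hcomp.freq_ne hk
  refine eq_of_mul_waveMean (ν := fun i => (θ i m).2.2 - (θ₀ j).2.2) hn
    ((continuous_amplitude.tendsto (τ m)).comp hθm) (hcomp.amplitude_ne_zero j) ?_ ?_
  · have hlim := (hself.sub (tendsto_spectrum_sub h fun _ => (θ₀ j).2.2)).sub hfit
    simpa only [sub_sub_cancel, sub_zero, Function.comp_apply] using hlim
  · have hlim := ((tendsto_spectrum_sub h fun i => (θ i m).2.2).add hself').sub htrue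
    simpa only [sub_add_cancel, sub_sub_cancel, zero_add, sub_zero, neg_sub] using hlim

theorem exists_perm_eq_of_tendsto_objective (hn : Tendsto n l atTop) (hθ : Tendsto θ l (𝓝 τ))
    (hτ : ∀ k, (τ k).2.2 ∈ freqSquare) (hcomp : HasGenuineComponents θ₀)
    (hθ₀ : ∀ k, (θ₀ k).2.2 ∈ regularFreq)
    (h : Tendsto (fun i => objective (signal θ₀) (n i).1 (n i).2 (θ i)) l (𝓝 0)) :
    ∃ σ : Equiv.Perm (Fin p), ∀ k, τ (σ k) = θ₀ k := by
  choose f hf using exists_freq_eq hn hθ hτ hcomp hθ₀ h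
  have hinj : Function.Injective f := fun j k hjk => by
    by_contra hne
    exact hcomp.freq_ne hne (by rw [← hf j, ← hf k, hjk])
  let σ := Equiv.ofBijective f (Finite.injective_iff_bijective.1 hinj)
  refine ⟨σ, fun j => eq_of_amplitude_eq ?_ (hf j)⟩
  refine amplitude_eq_of_freq_eq hn hθ hτ hcomp hθ₀ h (hf j) fun k hk hkj => ?_
  obtain ⟨i, rfl⟩ := σ.surjective k
  have hij : i ≠ j := fun hij => hk (by rw [hij])
  exact hcomp.freq_ne hij ((hf i).symm.trans hkj)

end Identifiability

section MeanGain

variable {μ : Measure ℝ}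

/-- The expected increase `E(|e + x| - |e|)` of the absolute error `|e|`, `e ∼ μ`, under a shift by
`x`. -/
noncomputable def meanGain (μ : Measure ℝ) (x : ℝ) : ℝ := ∫ e, (|e + x| - |e|) ∂μ

/-- The number `0` is the only median of `μ`: every `x < 0` has less than half of the mass at or
below it, and every `x > 0` has less than half of the mass at or above it. -/
def IsUniqueMedianZero (μ : Measure ℝ) : Prop :=
  (∀ x < 0, μ.real (Set.Iic x) < 1 / 2) ∧ ∀ x > 0, μ.real (Set.Ici x) < 1 / 2

lemma abs_abs_add_sub_abs_le (e x : ℝ) : |(|e + x| - |e|)| ≤ |x| := by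
  simpa only [add_sub_cancel_left] using abs_abs_sub_abs_le_abs_sub (e + x) e

lemma integrable_gain [IsFiniteMeasure μ] (x : ℝ) : Integrable (fun e => |e + x| - |e|) μ :=
  .of_bound (by fun_prop) |x| (ae_of_all _ fun e => abs_abs_add_sub_abs_le e x)

lemma abs_meanGain_sub_le [IsProbabilityMeasure μ] (x y : ℝ) :
    |meanGain μ x - meanGain μ y| ≤ |x - y| := by
  rw [meanGain, meanGain, ← integral_sub (integrable_gain x) (integrable_gain y)]
  have hbound : ∀ e : ℝ, ‖|e + x| - |e| - (|e + y| - |e|)‖ ≤ |x - y| := fun e => by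
    rw [sub_sub_sub_cancel_right, Real.norm_eq_abs, ← add_sub_add_left_eq_sub x y e]
    exact abs_abs_sub_abs_le_abs_sub _ _
  simpa only [probReal_univ, mul_one, Real.norm_eq_abs] using
    norm_integral_le_of_norm_le_const (μ := μ) (ae_of_all _ hbound)

lemma meanGain_map_neg (x : ℝ) : meanGain (μ.map Neg.neg) x = meanGain μ (-x) := by
  rw [meanGain, integral_map measurable_neg.aemeasurable
    (Measurable.aestronglyMeasurable (by fun_prop)), meanGain]
  refine integral_congr_ae (ae_of_all _ fun e => ?_)
  simp only [abs_neg, ← abs_neg (-e + x), neg_add, neg_neg]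

lemma mul_measureReal_sub_le_meanGain [IsFiniteMeasure μ] {x : ℝ} (hx : 0 < x) :
    x * (μ.real (Set.Ici 0) - μ.real (Set.Iic (-x / 2))) ≤ meanGain μ x := by
  have hint : ∀ s : Set ℝ, MeasurableSet s → Integrable (s.indicator fun _ => x) μ :=
    fun s hs => (integrable_const x).indicator hs
  have hpointwise : ∀ e : ℝ, (Set.Ici 0).indicator (fun _ => x) e
      - (Set.Iic (-x / 2)).indicator (fun _ => x) e ≤ |e + x| - |e| := fun e => by
    simp only [Set.indicator_apply, Set.mem_Ici, Set.mem_Iic]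
    split_ifs <;> cases abs_cases (e + x) <;> cases abs_cases e <;> linarith
  calc x * (μ.real (Set.Ici 0) - μ.real (Set.Iic (-x / 2)))
      = ∫ e, ((Set.Ici 0).indicator (fun _ => x) e
          - (Set.Iic (-x / 2)).indicator (fun _ => x) e) ∂μ := by
        rw [integral_sub (hint _ measurableSet_Ici) (hint _ measurableSet_Iic),
          integral_indicator_const _ measurableSet_Ici,
          integral_indicator_const _ measurableSet_Iic, smul_eq_mul, smul_eq_mul]
        ring
    _ ≤ meanGain μ x := integral_mono
        ((hint _ measurableSet_Ici).sub (hint _ measurableSet_Iic)) (integrable_gain x) hpointwise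

lemma half_le_measureReal_Ici_zero [IsProbabilityMeasure μ]
    (h : ∀ x < 0, μ.real (Set.Iic x) < 1 / 2) : 1 / 2 ≤ μ.real (Set.Ici 0) := by
  obtain ⟨u, hu, hu0, hlim⟩ := exists_seq_strictMono_tendsto (0 : ℝ)
  have hUnion : ⋃ n, Set.Iic (u n) = Set.Iio 0 := iUnion_Iic_eq_Iio_of_lt_of_tendsto hu0 hlim
  have hmono : Monotone fun n => Set.Iic (u n) :=
    fun _ _ hmn => Set.Iic_subset_Iic.2 (hu.monotone hmn)
  have htendsto := tendsto_measure_iUnion_atTop (μ := μ) hmono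
  rw [hUnion] at htendsto
  have hIio : μ.real (Set.Iio 0) ≤ 1 / 2 :=
    le_of_tendsto ((ENNReal.tendsto_toReal (measure_ne_top μ _)).comp htendsto)
      (.of_forall fun n => (h _ (hu0 n)).le)
  rw [← Set.compl_Iio, probReal_compl_eq_one_sub measurableSet_Iio]
  linarith

lemma exists_le_meanGain_of_nonneg [IsProbabilityMeasure μ]
    (h : ∀ x < 0, μ.real (Set.Iic x) < 1 / 2) {τ : ℝ} (hτ : 0 < τ) :
    ∃ κ > 0, ∀ x ≥ 0, κ * max (x - τ) 0 ≤ meanGain μ x := by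
  have hIci := half_le_measureReal_Ici_zero h
  have hκ : 0 < 1 / 2 - μ.real (Set.Iic (-τ / 2)) := sub_pos.2 (h _ (by linarith))
  refine ⟨_, hκ, fun x hx => ?_⟩
  rcases hx.eq_or_lt with rfl | hx
  · simp [meanGain, hτ.le]
  have hgain := mul_measureReal_sub_le_meanGain (μ := μ) hx
  rcases le_total x τ with hxτ | hτx
  · have hIic := h (-x / 2) (by linarith)
    rw [max_eq_right (sub_nonpos.2 hxτ)]
    nlinarith
  · have hIic : μ.real (Set.Iic (-x / 2)) ≤ μ.real (Set.Iic (-τ / 2)) :=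
      measureReal_mono (Set.Iic_subset_Iic.2 (by linarith))
    rw [max_eq_left (sub_nonneg.2 hτx)]
    nlinarith

lemma IsUniqueMedianZero.exists_le_meanGain [IsProbabilityMeasure μ] (h : IsUniqueMedianZero μ)
    {τ : ℝ} (hτ : 0 < τ) : ∃ κ > 0, ∀ x, κ * (|x| - τ) ≤ meanGain μ x := by
  have : IsProbabilityMeasure (μ.map Neg.neg) :=
    Measure.isProbabilityMeasure_map measurable_neg.aemeasurable
  have hneg : ∀ x < 0, (μ.map Neg.neg).real (Set.Iic x) < 1 / 2 := fun x hx => by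
    rw [map_measureReal_apply measurable_neg measurableSet_Iic, Set.neg_preimage, Set.neg_Iic]
    exact h.2 _ (neg_pos.2 hx)
  obtain ⟨κ₁, hκ₁, hright⟩ := exists_le_meanGain_of_nonneg h.1 hτ
  obtain ⟨κ₂, hκ₂, hleft⟩ := exists_le_meanGain_of_nonneg hneg hτ
  have hκ : 0 < min κ₁ κ₂ := lt_min hκ₁ hκ₂
  refine ⟨min κ₁ κ₂, hκ, fun x => ?_⟩
  calc min κ₁ κ₂ * (|x| - τ) ≤ min κ₁ κ₂ * max (|x| - τ) 0 := by
        gcongr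
        exact le_max_left _ _
    _ ≤ meanGain μ x := ?_
  rcases le_total 0 x with hx | hx
  · rw [abs_of_nonneg hx]
    refine le_trans ?_ (hright x hx)
    gcongr
    exact min_le_left _ _
  · rw [abs_of_nonpos hx, ← neg_neg x, ← meanGain_map_neg, neg_neg]
    refine le_trans ?_ (hleft (-x) (neg_nonneg.2 hx))
    gcongr
    exact min_le_right _ _

end MeanGain

section Covering

open Metric Module

variable {E : Type*} [NormedAddCommGroup E] [NormedSpace ℝ E] [FiniteDimensional ℝ E]

lemma card_le_of_pairwise_le_dist {R δ : ℝ} (hR : 0 ≤ R) (hδ : 0 < δ) {s : Finset E}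
    (hs : ↑s ⊆ closedBall (0 : E) R) (hsep : (s : Set E).Pairwise fun c d => δ ≤ dist c d) :
    (s.card : ℝ) ≤ (1 + 2 * R / δ) ^ finrank ℝ E := by
  borelize E
  let μ : Measure E := Measure.addHaar
  have hdisj : (s : Set E).PairwiseDisjoint fun c => ball c (δ / 2) := fun c hc d hd hcd =>
    ball_disjoint_ball (by linarith [hsep hc hd hcd])
  have hsub : ⋃ c ∈ s, ball c (δ / 2) ⊆ ball 0 (R + δ / 2) := Set.iUnion₂_subset fun c hc =>
    ball_subset_ball' (by linarith [mem_closedBall.1 (hs hc)])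
  have hball : ∀ (c : E) {r : ℝ}, 0 < r →
      μ.real (ball c r) = r ^ finrank ℝ E * μ.real (ball 0 1) := fun c r hr => by
    rw [measureReal_def, Measure.addHaar_ball_of_pos μ c hr, ENNReal.toReal_mul,
      ENNReal.toReal_ofReal (by positivity), measureReal_def]
  have hvolume : s.card * (δ / 2) ^ finrank ℝ E * μ.real (ball 0 1)
      ≤ (R + δ / 2) ^ finrank ℝ E * μ.real (ball 0 1) := by
    calc s.card * (δ / 2) ^ finrank ℝ E * μ.real (ball 0 1)
        = ∑ c ∈ s, μ.real (ball c (δ / 2)) := by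
          rw [Finset.sum_congr rfl fun c _ => hball c (half_pos hδ), Finset.sum_const,
            nsmul_eq_mul, mul_assoc]
      _ = μ.real (⋃ c ∈ s, ball c (δ / 2)) :=
          (measureReal_biUnion_finset hdisj (fun _ _ => measurableSet_ball)
            fun _ _ => measure_ball_lt_top.ne).symm
      _ ≤ μ.real (ball 0 (R + δ / 2)) := measureReal_mono hsub measure_ball_lt_top.ne
      _ = (R + δ / 2) ^ finrank ℝ E * μ.real (ball 0 1) := hball 0 (by positivity)
  have hunit : 0 < μ.real (ball 0 1) :=
    ENNReal.toReal_pos (measure_ball_pos μ _ one_pos).ne' measure_ball_lt_top.ne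
  calc (s.card : ℝ) ≤ (R + δ / 2) ^ finrank ℝ E / (δ / 2) ^ finrank ℝ E :=
        (le_div_iff₀ (by positivity)).2 (le_of_mul_le_mul_right hvolume hunit)
    _ = (1 + 2 * R / δ) ^ finrank ℝ E := by
        rw [← div_pow]
        congr 1
        field

lemma exists_finset_cover_closedBall {R δ : ℝ} (hR : 0 ≤ R) (hδ : 0 < δ) :
    ∃ s : Finset E, ↑s ⊆ closedBall (0 : E) R ∧ (s.card : ℝ) ≤ (1 + 2 * R / δ) ^ finrank ℝ E ∧
      ∀ x ∈ closedBall (0 : E) R, ∃ c ∈ s, dist x c ≤ δ := by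
  lift δ to NNReal using hδ.le
  have hproper := FiniteDimensional.proper_real E
  have hpacking : packingNumber δ (closedBall (0 : E) R) ≠ ⊤ := by
    obtain ⟨N, -, hN, hcover⟩ := exists_finite_isCover_of_isCompact
      (half_pos (NNReal.coe_pos.1 hδ)).ne' (isCompact_closedBall (0 : E) R)
    have h := packingNumber_two_mul_le_externalCoveringNumber (δ / 2) (closedBall (0 : E) R)
    rw [mul_div_cancel₀ _ two_ne_zero] at h
    exact ne_top_of_le_ne_top hN.encard_lt_top.ne
      (h.trans hcover.externalCoveringNumber_le_encard)
  have hfinite : (maximalSeparatedSet δ (closedBall (0 : E) R)).Finite :=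
    Set.encard_ne_top_iff.1 ((encard_maximalSeparatedSet hpacking).trans_ne hpacking)
  have hsub : ↑hfinite.toFinset ⊆ closedBall (0 : E) R :=
    hfinite.coe_toFinset.trans_subset maximalSeparatedSet_subset
  refine ⟨hfinite.toFinset, hsub, card_le_of_pairwise_le_dist hR hδ hsub ?_, fun x hx => ?_⟩
  · rw [hfinite.coe_toFinset]
    refine isSeparated_maximalSeparatedSet.imp fun c d hcd => ?_
    rw [edist_nndist, ENNReal.coe_lt_coe] at hcd
    exact_mod_cast hcd.le
  · obtain ⟨c, hc, hxc⟩ := isCover_maximalSeparatedSet hpacking hx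
    exact ⟨c, hfinite.mem_toFinset.2 hc, dist_le_coe.2 (edist_le_coe.1 hxc)⟩

end Covering

section BorelCantelli

variable {Ω : Type*} [MeasurableSpace Ω] {P : Measure Ω}

lemma ae_eventually_notMem_of_le {A : ℕ × ℕ → Set Ω} [IsFiniteMeasure P] {C : ℝ}
    (hA : ∀ n ≥ 1, P.real (A n) ≤ C * ((1 / (n.1 : ℝ) ^ 2) * (1 / (n.2 : ℝ) ^ 2))) :
    ∀ᵐ ω ∂P, ∀ᶠ n in atTop, ω ∉ A n := by
  have hsummable : Summable fun n : ℕ × ℕ =>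
      C * ((1 / (n.1 : ℝ) ^ 2) * (1 / (n.2 : ℝ) ^ 2)) := by
    have h := Real.summable_one_div_nat_pow.2 one_lt_two
    exact (h.mul_of_nonneg h (fun _ => by positivity) fun _ => by positivity).mul_left C
  let A' : ℕ × ℕ → Set Ω := fun n => {ω ∈ A n | 1 ≤ n}
  have hle : ∀ n, P (A' n) ≤ ENNReal.ofReal (C * ((1 / (n.1 : ℝ) ^ 2) * (1 / (n.2 : ℝ) ^ 2))) := by
    intro n
    by_cases hn : 1 ≤ n
    · simp only [A', hn, and_true, Set.ofPred_mem_eq]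
      rw [← ofReal_measureReal]
      exact ENNReal.ofReal_le_ofReal (hA n hn)
    · simp [A', hn]
  have hfinite : ∑' n, P (A' n) ≠ ⊤ :=
    ne_top_of_le_ne_top hsummable.tsum_ofReal_ne_top (ENNReal.tsum_le_tsum hle)
  filter_upwards [ae_finite_setOfPred_mem hfinite] with ω hω
  filter_upwards [atTop_le_cofinite hω.compl_mem_cofinite, eventually_ge_atTop 1] with n hn hn1 hmem
  exact hn ⟨hmem, hn1⟩

end BorelCantelli

section Concentration

open scoped BigOperators

variable {Ω : Type*} [MeasurableSpace Ω] {P : Measure Ω}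

lemma measureReal_abs_ge_le_of_hasSubgaussianMGF [IsFiniteMeasure P] {Y : Ω → ℝ}
    {v : NNReal} (hY : HasSubgaussianMGF Y v P) {r : ℝ} (hr : 0 ≤ r) :
    P.real {ω | r ≤ |Y ω|} ≤ 2 * Real.exp (-r ^ 2 / (2 * v)) :=
  calc P.real {ω | r ≤ |Y ω|} ≤ P.real ({ω | r ≤ Y ω} ∪ {ω | r ≤ (-Y) ω}) :=
        measureReal_mono fun ω (h : r ≤ |Y ω|) => le_abs.1 h
    _ ≤ P.real {ω | r ≤ Y ω} + P.real {ω | r ≤ (-Y) ω} := measureReal_union_le _ _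
    _ ≤ 2 * Real.exp (-r ^ 2 / (2 * v)) := by
        rw [two_mul]
        exact add_le_add (hY.measure_ge_le hr) (hY.neg.measure_ge_le hr)

lemma measureReal_abs_expect_sub_integral_ge_le [IsProbabilityMeasure P] {κ : Type*}
    {s : Finset κ} {X : κ → Ω → ℝ} (hX : ∀ i ∈ s, AEMeasurable (X i) P)
    (hindep : iIndepFun (fun i : s => X i) P) {M : ℝ} (hM : 0 ≤ M)
    (hbound : ∀ i ∈ s, ∀ᵐ ω ∂P, |X i ω| ≤ M) {η : ℝ} (hη : 0 ≤ η) :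
    P.real {ω | η ≤ |𝔼 i ∈ s, (X i ω - P[X i])|}
      ≤ 2 * Real.exp (-(η ^ 2 * s.card) / (2 * M ^ 2)) := by
  have hsub : ∀ i : s, HasSubgaussianMGF (fun ω => X i ω - P[X i]) ((‖M - -M‖₊ / 2) ^ 2) P :=
    fun i => hasSubgaussianMGF_of_mem_Icc (hX i i.2)
      ((hbound i i.2).mono fun _ h => abs_le.1 h)
  have hindep' : iIndepFun (fun (i : s) ω => X i ω - P[X i]) P :=
    hindep.comp (fun (i : s) x => x - ∫ ω, X i ω ∂P) fun _ => measurable_id.sub_const _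
  have hsum := HasSubgaussianMGF.sum_of_iIndepFun hindep' (s := Finset.univ) fun i _ => hsub i
  have hvariance : ((∑ _i : s, (‖M - -M‖₊ / 2) ^ 2 : NNReal) : ℝ) = s.card * M ^ 2 := by
    simp [Real.norm_of_nonneg hM, ← two_mul]
  have hexp : -(η * s.card) ^ 2 / (2 * (s.card * M ^ 2)) = -(η ^ 2 * s.card) / (2 * M ^ 2) := by
    rcases s.card.eq_zero_or_pos with h | h
    · simp [h]
    · field
  have htail := measureReal_abs_ge_le_of_hasSubgaussianMGF hsum (r := η * s.card) (by positivity)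
  rw [hvariance, hexp] at htail
  refine (measureReal_mono fun ω hω => ?_).trans htail
  rw [Set.mem_ofPred_eq, Finset.expect_eq_sum_div_card, abs_div, Nat.abs_cast] at hω
  rw [Set.mem_ofPred_eq, Finset.sum_coe_sort s fun i => X i ω - P[X i]]
  exact mul_le_of_le_div₀ (abs_nonneg _) (by positivity) hω

end Concentration

section UniformLaw

open Metric Module

variable {Ω : Type*} [MeasurableSpace Ω] {P : Measure Ω} [IsFiniteMeasure P]
  {E : Type*} [NormedAddCommGroup E] [NormedSpace ℝ E] [FiniteDimensional ℝ E]
  {R : ℝ} {F : ℕ × ℕ → E → Ω → ℝ}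

lemma pow_mul_exp_neg_le {c N : ℝ} (hc : 0 < c) (hN : 0 < N) (d : ℕ) :
    N ^ d * Real.exp (-(c * N)) ≤ (d + 2).factorial / c ^ (d + 2) * (1 / N ^ 2) := by
  have h := Real.pow_div_factorial_le_exp (c * N) (by positivity) (d + 2)
  rw [div_le_iff₀ (by positivity), mul_pow] at h
  rw [Real.exp_neg, ← div_eq_mul_inv, div_le_iff₀ (Real.exp_pos _)]
  calc N ^ d = c ^ (d + 2) * N ^ (d + 2) / (c ^ (d + 2) * N ^ 2) := by field
    _ ≤ Real.exp (c * N) * (d + 2).factorial / (c ^ (d + 2) * N ^ 2) := by gcongr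
    _ = _ := by field

-- The `N ^ finrank` net points at scale `1 / N` cost only a polynomial factor against `exp (-c N)`.
lemma measureReal_exists_closedBall_le (hR : 0 ≤ R) {K c η N : ℝ} (hK : 0 ≤ K) (hη : 0 < η)
    (hN : 1 ≤ N) {f : E → Ω → ℝ}
    (hlip : ∀ ω, ∀ θ ∈ closedBall 0 R, ∀ θ' ∈ closedBall 0 R,
      |f θ ω - f θ' ω| ≤ K * N * dist θ θ')
    (htail : ∀ θ ∈ closedBall 0 R, P.real {ω | η ≤ |f θ ω|} ≤ 2 * Real.exp (-(c * N))) :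
    P.real {ω | ∃ θ ∈ closedBall 0 R, 2 * η ≤ |f θ ω|}
      ≤ 2 * (1 + 2 * R * ((K + 1) / η)) ^ finrank ℝ E
        * (N ^ finrank ℝ E * Real.exp (-(c * N))) := by
  obtain ⟨s, hs, hcard, hcover⟩ := exists_finset_cover_closedBall (E := E) hR
    (δ := η / ((K + 1) * N)) (by positivity)
  have hsub : {ω | ∃ θ ∈ closedBall 0 R, 2 * η ≤ |f θ ω|} ⊆ ⋃ θ ∈ s, {ω | η ≤ |f θ ω|} := by
    rintro ω ⟨θ, hθ, hbig⟩
    obtain ⟨θ', hθ', hdist⟩ := hcover θ hθ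
    refine Set.mem_biUnion hθ' ?_
    have hclose : |f θ ω - f θ' ω| ≤ η := calc
      |f θ ω - f θ' ω| ≤ K * N * dist θ θ' := hlip ω θ hθ θ' (hs hθ')
      _ ≤ (K + 1) * N * (η / ((K + 1) * N)) := by gcongr; linarith
      _ = η := mul_div_cancel₀ _ (by positivity)
    have htri := abs_sub_abs_le_abs_sub (f θ ω) (f θ' ω)
    simp only [Set.mem_ofPred_eq]
    linarith
  calc P.real {ω | ∃ θ ∈ closedBall 0 R, 2 * η ≤ |f θ ω|}
      ≤ ∑ θ ∈ s, P.real {ω | η ≤ |f θ ω|} :=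
        (measureReal_mono hsub (measure_ne_top P _)).trans (measureReal_biUnion_finset_le s _)
    _ ≤ s.card * (2 * Real.exp (-(c * N))) := by
        rw [← nsmul_eq_mul]
        exact Finset.sum_le_card_nsmul s _ _ fun θ hθ => htail θ (hs hθ)
    _ ≤ ((1 + 2 * R * ((K + 1) / η)) * N) ^ finrank ℝ E * (2 * Real.exp (-(c * N))) := by
        gcongr
        refine hcard.trans (pow_le_pow_left₀ (by positivity) ?_ _)
        calc 1 + 2 * R / (η / ((K + 1) * N)) = 1 + 2 * R * ((K + 1) / η) * N := by field
          _ ≤ (1 + 2 * R * ((K + 1) / η)) * N := by rw [add_mul, one_mul]; gcongr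
    _ = _ := by rw [mul_pow]; ring

theorem ae_tendstoUniformlyOn_of_lipschitz_of_tail (hR : 0 ≤ R) {K : ℝ} (hK : 0 ≤ K)
    (hlip : ∀ n ≥ 1, ∀ ω, ∀ θ ∈ closedBall 0 R, ∀ θ' ∈ closedBall 0 R,
      |F n θ ω - F n θ' ω| ≤ K * (n.1 * n.2 : ℝ) * dist θ θ')
    (htail : ∀ η > 0, ∃ c > 0, ∀ n ≥ 1, ∀ θ ∈ closedBall 0 R,
      P.real {ω | η ≤ |F n θ ω|} ≤ 2 * Real.exp (-(c * (n.1 * n.2)))) :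
    ∀ᵐ ω ∂P, TendstoUniformlyOn (fun n θ => F n θ ω) 0 atTop (closedBall 0 R) := by
  have hsmall : ∀ η > 0, ∀ᵐ ω ∂P, ∀ᶠ n in atTop, ∀ θ ∈ closedBall 0 R, |F n θ ω| < 2 * η := by
    intro η hη
    obtain ⟨c, hc, htail⟩ := htail η hη
    let C := 2 * (1 + 2 * R * ((K + 1) / η)) ^ finrank ℝ E
    have hsummable : ∀ n ≥ 1, P.real {ω | ∃ θ ∈ closedBall 0 R, 2 * η ≤ |F n θ ω|} ≤
        C * ((finrank ℝ E + 2).factorial / c ^ (finrank ℝ E + 2))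
          * ((1 / (n.1 : ℝ) ^ 2) * (1 / (n.2 : ℝ) ^ 2)) := by
      intro n hn
      have hN : 1 ≤ (n.1 * n.2 : ℝ) := by exact_mod_cast Nat.mul_pos hn.1 hn.2
      have hdecay := pow_mul_exp_neg_le hc (zero_lt_one.trans_le hN) (finrank ℝ E)
      refine (measureReal_exists_closedBall_le hR hK hη hN (hlip n hn) (htail n hn)).trans ?_
      rw [one_div_mul_one_div, ← mul_pow, mul_assoc C]
      exact mul_le_mul_of_nonneg_left hdecay (by positivity)
    filter_upwards [ae_eventually_notMem_of_le hsummable] with ω hω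
    filter_upwards [hω] with n hn θ hθ
    exact lt_of_not_ge fun h => hn ⟨θ, hθ, h⟩
  filter_upwards [ae_all_iff.2 fun m : ℕ => hsmall (1 / (m + 1)) (by positivity)] with ω hω
  refine Metric.tendstoUniformlyOn_iff.2 fun η hη => ?_
  obtain ⟨m, hm⟩ := exists_nat_one_div_lt (half_pos hη)
  filter_upwards [hω m] with n hn θ hθ
  rw [Pi.zero_apply, dist_zero_left, Real.norm_eq_abs]
  linarith [hn θ hθ]

end UniformLaw

section SignalBounds

variable {p : ℕ} {R : ℝ}

lemma abs_mul_cos_add_mul_sin_le (a b x : ℝ) :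
    |a * Real.cos x + b * Real.sin x| ≤ |a| + |b| := by
  refine (abs_add_le _ _).trans ?_
  rw [abs_mul, abs_mul]
  exact add_le_add (mul_le_of_le_one_right (abs_nonneg a) (Real.abs_cos_le_one x))
    (mul_le_of_le_one_right (abs_nonneg b) (Real.abs_sin_le_one x))

lemma abs_mul_cos_add_mul_sin_sub_le (a b x y : ℝ) :
    |a * Real.cos x + b * Real.sin x - (a * Real.cos y + b * Real.sin y)|
      ≤ (|a| + |b|) * |x - y| := by
  rw [add_sub_add_comm, ← mul_sub, ← mul_sub, add_mul]
  refine (abs_add_le _ _).trans ?_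
  rw [abs_mul, abs_mul]
  exact add_le_add (mul_le_mul_of_nonneg_left (Real.abs_cos_sub_cos_le x y) (abs_nonneg a))
    (mul_le_mul_of_nonneg_left (Real.abs_sin_sub_sin_le x y) (abs_nonneg b))

lemma abs_add_abs_le_two_mul_norm (q : ℝ × ℝ × ℝ × ℝ) : |q.1| + |q.2.1| ≤ 2 * ‖q‖ := by
  rw [two_mul]
  exact add_le_add (norm_fst_le q) ((norm_fst_le q.2).trans (norm_snd_le q))

lemma abs_component_le (q : ℝ × ℝ × ℝ × ℝ) (i : ℕ × ℕ) : |component q i| ≤ 2 * ‖q‖ :=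
  (abs_mul_cos_add_mul_sin_le _ _ _).trans (abs_add_abs_le_two_mul_norm q)

lemma abs_component_sub_le (q r : ℝ × ℝ × ℝ × ℝ) (i : ℕ × ℕ) :
    |component q i - component r i| ≤ 2 * (1 + ‖r‖ * (i.1 + i.2)) * dist q r := by
  let phase (ν : ℝ × ℝ) : ℝ := ν.1 * i.1 + ν.2 * i.2
  have hamplitude :
      |component q i - (r.1 * Real.cos (phase q.2.2) + r.2.1 * Real.sin (phase q.2.2))|
        ≤ 2 * dist q r := by
    rw [component, add_sub_add_comm, ← sub_mul, ← sub_mul, dist_eq_norm]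
    exact (abs_mul_cos_add_mul_sin_le _ _ _).trans (abs_add_abs_le_two_mul_norm (q - r))
  have hphase : |phase q.2.2 - phase r.2.2| ≤ (i.1 + i.2) * dist q r := by
    have hfreq : ‖(q - r).2.2‖ ≤ dist q r := by
      rw [dist_eq_norm]
      exact (norm_snd_le _).trans (norm_snd_le _)
    calc |phase q.2.2 - phase r.2.2| = |(q - r).2.2.1 * i.1 + (q - r).2.2.2 * i.2| := by
          simp only [phase, Prod.fst_sub, Prod.snd_sub]
          ring_nf
      _ ≤ |(q - r).2.2.1| * i.1 + |(q - r).2.2.2| * i.2 := by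
          refine (abs_add_le _ _).trans_eq ?_
          rw [abs_mul, abs_mul, Nat.abs_cast, Nat.abs_cast]
      _ ≤ dist q r * i.1 + dist q r * i.2 := by
          gcongr
          exacts [(norm_fst_le _).trans hfreq, (norm_snd_le _).trans hfreq]
      _ = (i.1 + i.2) * dist q r := by ring
  calc |component q i - component r i|
      ≤ 2 * dist q r + (|r.1| + |r.2.1|) * |phase q.2.2 - phase r.2.2| :=
        (abs_sub_le _ _ _).trans
          (add_le_add hamplitude (abs_mul_cos_add_mul_sin_sub_le _ _ _ _))
    _ ≤ 2 * dist q r + 2 * ‖r‖ * ((i.1 + i.2) * dist q r) := by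
        gcongr
        exact abs_add_abs_le_two_mul_norm r
    _ = 2 * (1 + ‖r‖ * (i.1 + i.2)) * dist q r := by ring

lemma abs_signal_le (θ : Param p) (i : ℕ × ℕ) : |signal θ i.1 i.2| ≤ 2 * p * ‖θ‖ := by
  rw [signal_eq_sum_component]
  calc |∑ k, component (θ k) i| ≤ ∑ k, |component (θ k) i| := Finset.abs_sum_le_sum_abs _ _
    _ ≤ ∑ _k : Fin p, 2 * ‖θ‖ := Finset.sum_le_sum fun k _ =>
        (abs_component_le _ i).trans (by gcongr; exact norm_le_pi_norm θ k)
    _ = 2 * p * ‖θ‖ := by simp [mul_left_comm, mul_assoc]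

lemma abs_signal_sub_le (θ θ' : Param p) (hR : ‖θ'‖ ≤ R) {i n : ℕ × ℕ} (hi : i ∈ Finset.Icc 1 n) :
    |signal θ i.1 i.2 - signal θ' i.1 i.2|
      ≤ 2 * p * (1 + 2 * R) * (n.1 * n.2) * dist θ θ' := by
  obtain ⟨h1, hin⟩ := Finset.mem_Icc.1 hi
  have hR0 : 0 ≤ R := (norm_nonneg _).trans hR
  have hgrid : (i.1 + i.2 : ℝ) ≤ 2 * (n.1 * n.2) := by
    have h := Nat.add_le_add (Nat.le_mul_of_pos_right n.1 (h1.2.trans hin.2))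
      (Nat.le_mul_of_pos_left n.2 (h1.1.trans hin.1))
    rw [← two_mul] at h
    exact_mod_cast (Nat.add_le_add hin.1 hin.2).trans h
  have hone : 1 ≤ (n.1 * n.2 : ℝ) := by
    exact_mod_cast Nat.mul_pos (h1.1.trans hin.1) (h1.2.trans hin.2)
  rw [signal_eq_sum_component, signal_eq_sum_component, ← Finset.sum_sub_distrib]
  calc |∑ k, (component (θ k) i - component (θ' k) i)|
      ≤ ∑ k, |component (θ k) i - component (θ' k) i| := Finset.abs_sum_le_sum_abs _ _
    _ ≤ ∑ _k : Fin p, 2 * (n.1 * n.2 + R * (2 * (n.1 * n.2))) * dist θ θ' :=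
        Finset.sum_le_sum fun k _ => (abs_component_sub_le _ _ i).trans (by
          gcongr
          exacts [(norm_le_pi_norm θ' k).trans hR, dist_le_pi_dist θ θ' k])
    _ = 2 * p * (1 + 2 * R) * (n.1 * n.2) * dist θ θ' := by
        rw [Finset.sum_const, Finset.card_univ, Fintype.card_fin, nsmul_eq_mul]
        ring

end SignalBounds

section Fluctuation

open scoped BigOperators

variable {Ω : Type*} [MeasurableSpace Ω] {P : Measure Ω} [IsProbabilityMeasure P]
  {μ : Measure ℝ}

/-- The mean over the grid `1 ≤ i ≤ n` of the increase of the absolute errors `|e i|` under the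
shifts `d i`, centred by its expectation for errors distributed as `μ`. -/
noncomputable def gainFluctuation (μ : Measure ℝ) (e d : ℕ × ℕ → ℝ) (n : ℕ × ℕ) : ℝ :=
  𝔼 i ∈ Finset.Icc 1 n, (|e i + d i| - |e i| - meanGain μ (d i))

lemma abs_gainFluctuation_sub_le [IsProbabilityMeasure μ] (e : ℕ × ℕ → ℝ) {d d' : ℕ × ℕ → ℝ}
    {n : ℕ × ℕ} (hn : 1 ≤ n) {C : ℝ} (h : ∀ i ∈ Finset.Icc 1 n, |d i - d' i| ≤ C) :
    |gainFluctuation μ e d n - gainFluctuation μ e d' n| ≤ 2 * C := by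
  rw [gainFluctuation, gainFluctuation, ← Finset.expect_sub_distrib]
  refine (Finset.abs_expect_le _ _).trans
    (Finset.expect_le (Finset.nonempty_Icc.2 hn) fun i hi => ?_)
  have hgain := abs_abs_sub_abs_le_abs_sub (e i + d i) (e i + d' i)
  rw [add_sub_add_left_eq_sub] at hgain
  have hmean := abs_meanGain_sub_le (μ := μ) (d i) (d' i)
  calc |(|e i + d i| - |e i| - meanGain μ (d i) - (|e i + d' i| - |e i| - meanGain μ (d' i)))|
      = |(|e i + d i| - |e i + d' i|) - (meanGain μ (d i) - meanGain μ (d' i))| := by ring_nf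
    _ ≤ |(|e i + d i| - |e i + d' i|)| + |meanGain μ (d i) - meanGain μ (d' i)| := abs_sub _ _
    _ ≤ 2 * C := by linarith [h i hi]

lemma measureReal_gainFluctuation_ge_le {ε : ℕ × ℕ → Ω → ℝ} {n : ℕ × ℕ}
    (hindep : iIndepFun (fun i : Finset.Icc 1 n => ε i) P)
    (hlaw : ∀ i ∈ Finset.Icc 1 n, HasLaw (ε i) μ P) {d : ℕ × ℕ → ℝ} {M : ℝ} (hM : 0 ≤ M)
    (hd : ∀ i, |d i| ≤ M) {η : ℝ} (hη : 0 ≤ η) :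
    P.real {ω | η ≤ |gainFluctuation μ (fun i => ε i ω) d n|}
      ≤ 2 * Real.exp (-(η ^ 2 / (2 * M ^ 2) * (n.1 * n.2))) := by
  let gain (i : ℕ × ℕ) (e : ℝ) : ℝ := |e + d i| - |e|
  have hmean : ∀ i ∈ Finset.Icc 1 n, ∫ ω, gain i (ε i ω) ∂P = meanGain μ (d i) := fun i hi =>
    (hlaw i hi).integral_comp (f := gain i) (by fun_prop)
  have hmeas : ∀ i, Measurable (gain i) := fun i => by fun_prop
  have h := measureReal_abs_expect_sub_integral_ge_le (X := fun i ω => gain i (ε i ω))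
    (fun i hi => (hmeas i).comp_aemeasurable (hlaw i hi).aemeasurable)
    (hindep.comp (fun i => gain i) fun i => hmeas i) hM
    (fun i _ => ae_of_all _ fun ω => (abs_abs_add_sub_abs_le _ _).trans (hd i)) hη
  have hfluctuation : ∀ ω, 𝔼 i ∈ Finset.Icc 1 n, (gain i (ε i ω) - ∫ ω, gain i (ε i ω) ∂P)
      = gainFluctuation μ (fun i => ε i ω) d n := fun ω =>
    Finset.expect_congr rfl fun i hi => by rw [hmean i hi]
  have hcard : ((Finset.Icc 1 n).card : ℝ) = n.1 * n.2 := by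
    simp [Finset.Icc_prod_def, Finset.card_product]
  simpa only [hfluctuation, hcard, neg_div, mul_div_right_comm] using h

lemma ae_tendstoUniformlyOn_gainFluctuation {ε : ℕ × ℕ → Ω → ℝ}
    (hindep : iIndepFun (fun i : Set.Ici (1 : ℕ × ℕ) => ε i) P)
    (hlaw : ∀ i ≥ 1, HasLaw (ε i) μ P) {p : ℕ} (θ₀ : Param p) {R : ℝ} (hR : 0 ≤ R) :
    ∀ᵐ ω ∂P, TendstoUniformlyOn
      (fun n (θ : Param p) => gainFluctuation μ (fun i => ε i ω)
        (fun i => signal θ₀ i.1 i.2 - signal θ i.1 i.2) n)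
      0 atTop (Metric.closedBall 0 R) := by
  have hμ : IsProbabilityMeasure μ := (hlaw 1 le_rfl).isProbabilityMeasure_iff.1 inferInstance
  let F (n : ℕ × ℕ) (θ : Param p) (ω : Ω) : ℝ := gainFluctuation μ (fun i => ε i ω)
    (fun i => signal θ₀ i.1 i.2 - signal θ i.1 i.2) n
  have hlip : ∀ n ≥ 1, ∀ ω, ∀ θ ∈ Metric.closedBall 0 R, ∀ θ' ∈ Metric.closedBall 0 R,
      |F n θ ω - F n θ' ω| ≤ 2 * (2 * p * (1 + 2 * R)) * (n.1 * n.2) * dist θ θ' := by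
    intro n hn ω θ hθ θ' _
    have h : ∀ i ∈ Finset.Icc 1 n,
        |signal θ₀ i.1 i.2 - signal θ i.1 i.2 - (signal θ₀ i.1 i.2 - signal θ' i.1 i.2)|
          ≤ 2 * p * (1 + 2 * R) * (n.1 * n.2) * dist θ θ' := fun i hi => by
      rw [sub_sub_sub_cancel_left, dist_comm]
      exact abs_signal_sub_le θ' θ (mem_closedBall_zero_iff.1 hθ) hi
    simpa only [mul_assoc] using abs_gainFluctuation_sub_le (μ := μ) (fun i => ε i ω) hn h
  have htail : ∀ η > 0, ∃ c > 0, ∀ n ≥ 1, ∀ θ ∈ Metric.closedBall 0 R,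
      P.real {ω | η ≤ |F n θ ω|} ≤ 2 * Real.exp (-(c * (n.1 * n.2))) := by
    intro η hη
    let M : ℝ := 2 * p * ‖θ₀‖ + 2 * p * R + 1
    refine ⟨η ^ 2 / (2 * M ^ 2), by positivity, fun n _ θ hθ => ?_⟩
    refine measureReal_gainFluctuation_ge_le
      (hindep.precomp (g := Set.inclusion fun i hi => (Finset.mem_Icc.1 hi).1)
        (Set.inclusion_injective _))
      (fun i hi => hlaw i (Finset.mem_Icc.1 hi).1) (by positivity) (fun i => ?_) hη.le
    have hθ' : 2 * p * ‖θ‖ ≤ 2 * p * R := by gcongr; exact mem_closedBall_zero_iff.1 hθ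
    linarith [abs_sub (signal θ₀ i.1 i.2) (signal θ i.1 i.2), abs_signal_le θ₀ i, abs_signal_le θ i]
  exact ae_tendstoUniformlyOn_of_lipschitz_of_tail hR (by positivity) hlip htail

end Fluctuation

section Consistency

open scoped BigOperators

variable {p : ℕ} {θ₀ : Param p} {μ : Measure ℝ} {y : ℕ → ℕ → ℝ} {e : ℕ × ℕ → ℝ}

lemma objective_sub_objective (μ : Measure ℝ) {n : ℕ × ℕ}
    (hy : ∀ i ∈ Finset.Icc 1 n, y i.1 i.2 = signal θ₀ i.1 i.2 + e i) (θ : Param p) :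
    objective y n.1 n.2 θ - objective y n.1 n.2 θ₀
      = gainFluctuation μ e (fun i => signal θ₀ i.1 i.2 - signal θ i.1 i.2) n
        + 𝔼 i ∈ Finset.Icc 1 n, meanGain μ (signal θ₀ i.1 i.2 - signal θ i.1 i.2) := by
  rw [objective_eq_expect, objective_eq_expect, gainFluctuation, ← Finset.expect_sub_distrib,
    ← Finset.expect_add_distrib]
  refine Finset.expect_congr rfl fun i hi => ?_
  rw [hy i hi, add_sub_cancel_left, sub_add_cancel, add_sub_right_comm, add_comm (e i)]

lemma mul_objective_signal_sub_le {n : ℕ × ℕ} (hn : 1 ≤ n)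
    (hy : ∀ i ∈ Finset.Icc 1 n, y i.1 i.2 = signal θ₀ i.1 i.2 + e i) {κ τ : ℝ}
    (hgain : ∀ x, κ * (|x| - τ) ≤ meanGain μ x) {θ : Param p}
    (hmin : objective y n.1 n.2 θ ≤ objective y n.1 n.2 θ₀) :
    κ * (objective (signal θ₀) n.1 n.2 θ - τ)
      ≤ |gainFluctuation μ e (fun i => signal θ₀ i.1 i.2 - signal θ i.1 i.2) n| := by
  have hgain' : κ * (objective (signal θ₀) n.1 n.2 θ - τ)
      ≤ 𝔼 i ∈ Finset.Icc 1 n, meanGain μ (signal θ₀ i.1 i.2 - signal θ i.1 i.2) := by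
    rw [objective_eq_expect, ← Finset.expect_const (Finset.nonempty_Icc.2 hn) τ,
      ← Finset.expect_sub_distrib, Finset.mul_expect]
    exact Finset.expect_le_expect fun i _ => hgain _
  have hsub := objective_sub_objective μ hy θ
  linarith [neg_abs_le
    (gainFluctuation μ e (fun i => signal θ₀ i.1 i.2 - signal θ i.1 i.2) n)]

lemma tendsto_objective_signal [IsProbabilityMeasure μ] (hμ : IsUniqueMedianZero μ)
    (hy : ∀ i ≥ 1, y i.1 i.2 = signal θ₀ i.1 i.2 + e i) {Θ : Set (Param p)}
    (hunif : TendstoUniformlyOn (fun n (θ : Param p) => gainFluctuation μ e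
      (fun i => signal θ₀ i.1 i.2 - signal θ i.1 i.2) n) 0 atTop Θ)
    {θ : ℕ × ℕ → Param p} (hθ : ∀ n ≥ 1, θ n ∈ Θ)
    (hmin : ∀ n ≥ 1, objective y n.1 n.2 (θ n) ≤ objective y n.1 n.2 θ₀) :
    Tendsto (fun n => objective (signal θ₀) n.1 n.2 (θ n)) atTop (𝓝 0) := by
  rw [Metric.tendsto_nhds]
  intro δ hδ
  obtain ⟨κ, hκ, hgain⟩ := hμ.exists_le_meanGain (half_pos hδ)
  filter_upwards [eventually_ge_atTop 1,
    Metric.tendstoUniformlyOn_iff.1 hunif _ (mul_pos hκ (half_pos hδ))] with n hn hsmall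
  have hfluctuation := hsmall (θ n) (hθ n hn)
  rw [Pi.zero_apply, dist_zero_left, Real.norm_eq_abs] at hfluctuation
  have hle := mul_objective_signal_sub_le hn (fun i hi => hy i (Finset.mem_Icc.1 hi).1) hgain
    (hmin n hn)
  have hlt := lt_of_mul_lt_mul_left (hle.trans_lt hfluctuation) hκ.le
  have hnonneg : 0 ≤ objective (signal θ₀) n.1 n.2 (θ n) := by
    rw [objective_eq_expect]
    exact Finset.expect_nonneg fun i _ => abs_nonneg _
  rw [Real.dist_0_eq_abs, abs_of_nonneg hnonneg]
  linarith

lemma exists_perm_tendsto {ι : Type*} {l : Filter ι} {n : ι → ℕ × ℕ} (hn : Tendsto n l atTop)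
    {Θ : Set (Param p)} (hΘ : IsCompact Θ) (hfreq : ∀ θ ∈ Θ, ∀ k, (θ k).2.2 ∈ freqSquare)
    (hcomp : HasGenuineComponents θ₀) (hθ₀ : ∀ k, (θ₀ k).2.2 ∈ regularFreq)
    {θ : ι → Param p} (hθ : ∀ᶠ i in l, θ i ∈ Θ)
    (h : Tendsto (fun i => objective (signal θ₀) (n i).1 (n i).2 (θ i)) l (𝓝 0)) :
    ∃ σ : ι → Equiv.Perm (Fin p), Tendsto (fun i k => θ i (σ i k)) l (𝓝 θ₀) := by
  choose σ hσ using fun i =>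
    Finite.exists_min fun σ : Equiv.Perm (Fin p) => dist (fun k => θ i (σ k)) θ₀
  refine ⟨σ, ?_⟩
  rw [tendsto_iff_dist_tendsto_zero, tendsto_iff_ultrafilter]
  intro U hU
  obtain ⟨τ, hτ, hlim⟩ : ∃ τ ∈ Θ, Tendsto θ U (𝓝 τ) :=
    hΘ.ultrafilter_le_nhds (U.map θ) (le_principal_iff.2 (hU hθ))
  obtain ⟨ρ, hρ⟩ := exists_perm_eq_of_tendsto_objective (hn.mono_left hU) hlim (hfreq τ hτ) hcomp
    hθ₀ (h.mono_left hU)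
  have hconv : Tendsto (fun i k => θ i (ρ k)) U (𝓝 θ₀) :=
    tendsto_pi_nhds.2 fun k => hρ k ▸ hlim.apply_nhds (ρ k)
  exact squeeze_zero (fun _ => dist_nonneg) (fun i => hσ i ρ)
    (tendsto_iff_dist_tendsto_zero.1 hconv)

lemma comap_min_atTop : comap (fun n : ℕ × ℕ => min n.1 n.2) atTop = atTop := by
  refine le_antisymm ?_ (tendsto_iff_comap.1 ?_)
  · rw [← prod_atTop_atTop_eq]
    exact le_prod.2 ⟨tendsto_atTop_mono (fun _ => min_le_left _ _) tendsto_comap,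
      tendsto_atTop_mono (fun _ => min_le_right _ _) tendsto_comap⟩
  · exact tendsto_atTop_atTop.2 fun b => ⟨(b, b), fun _ hn => le_min hn.1 hn.2⟩

end Consistency

section ParamSpace

variable {p : ℕ} {K : Set ℝ} {θ : Param p}

lemma isCompact_paramSpace (hK : IsCompact K) : IsCompact (paramSpace p K) :=
  isCompact_univ_pi fun _ => hK.prod (hK.prod (isCompact_Icc.prod isCompact_Icc))

lemma mem_freqSquare_of_mem_paramSpace (hθ : θ ∈ paramSpace p K) (k : Fin p) :
    (θ k).2.2 ∈ freqSquare :=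
  (hθ k (Set.mem_univ k)).2.2

lemma mem_regularFreq_of_mem_interior_paramSpace (hθ : θ ∈ interior (paramSpace p K))
    (k : Fin p) : (θ k).2.2 ∈ regularFreq := by
  refine ⟨mem_freqSquare_of_mem_paramSpace (interior_subset hθ) k, Or.inl ?_⟩
  rw [paramSpace, interior_pi_set Set.finite_univ] at hθ
  have h := hθ k (Set.mem_univ k)
  simp only [interior_prod_eq, interior_Icc] at h
  exact h.2.2.1

end ParamSpace

section Noise

variable {Ω : Type*} [MeasurableSpace Ω] {P : Measure Ω} {ε : ℕ → ℕ → Ω → ℝ} {G g : ℝ → ℝ}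

lemma isUniqueMedianZero_of_real_Iic {μ : Measure ℝ} [IsProbabilityMeasure μ]
    (hG : ∀ x, μ.real (Set.Iic x) = G x) (hmedian : ∀ x, G x = 1 / 2 ↔ x = 0) :
    IsUniqueMedianZero μ := by
  have hmono : Monotone G := fun x x' h => by
    rw [← hG, ← hG]
    exact measureReal_mono (Set.Iic_subset_Iic.2 h)
  have hzero : G 0 = 1 / 2 := (hmedian 0).2 rfl
  refine ⟨fun x hx => ?_, fun x hx => ?_⟩
  · rw [hG]
    exact lt_of_le_of_ne (hzero ▸ hmono hx.le) fun h => hx.ne ((hmedian x).1 h)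
  · have hhalf : 1 / 2 < G (x / 2) := lt_of_le_of_ne (hzero ▸ hmono (half_pos hx).le) fun h =>
      (half_pos hx).ne' ((hmedian _).1 h.symm)
    calc μ.real (Set.Ici x) ≤ μ.real (Set.Iic (x / 2))ᶜ :=
          measureReal_mono fun z hz => not_le.2 ((half_lt_self hx).trans_le hz)
      _ = 1 - G (x / 2) := by rw [probReal_compl_eq_one_sub measurableSet_Iic, hG]
      _ < 1 / 2 := by linarith

lemma NoiseAssumption.hasLaw (h : NoiseAssumption P ε G g) {t s : ℕ} (ht : 1 ≤ t) (hs : 1 ≤ s) :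
    HasLaw (ε t s) (P.map (ε 1 1)) P where
  aemeasurable := (h.measurable t s ht hs).aemeasurable
  map_eq := by rw [h.density t s ht hs, h.density 1 1 le_rfl le_rfl]

lemma NoiseAssumption.isUniqueMedianZero [IsProbabilityMeasure P] (h : NoiseAssumption P ε G g) :
    IsUniqueMedianZero (P.map (ε 1 1)) := by
  have hlaw := h.hasLaw le_rfl le_rfl
  have hprob := hlaw.isProbabilityMeasure_iff.1 ‹_›
  refine isUniqueMedianZero_of_real_Iic (fun x => ?_) h.median
  rw [← h.distribution 1 1 le_rfl le_rfl x]
  exact (hlaw.measureReal_eq measurableSet_Iic).symm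

lemma NoiseAssumption.iIndepFun_Ici (h : NoiseAssumption P ε G g) :
    iIndepFun (fun i : Set.Ici (1 : ℕ × ℕ) => ε i.1.1 i.1.2) P := by
  let pred (i : Set.Ici (1 : ℕ × ℕ)) : ℕ × ℕ := (i.1.1 - 1, i.1.2 - 1)
  have hpred : ∀ i, ((pred i).1 + 1, (pred i).2 + 1) = i.1 := fun i =>
    Prod.ext (Nat.sub_add_cancel i.2.1) (Nat.sub_add_cancel i.2.2)
  have hinj : Function.Injective pred := fun i j hij =>
    Subtype.ext (by rw [← hpred i, ← hpred j, hij])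
  have heq : (fun i : Set.Ici (1 : ℕ × ℕ) => ε i.1.1 i.1.2)
      = fun i => ε ((pred i).1 + 1) ((pred i).2 + 1) := by
    funext i
    rw [← hpred i]
  rw [heq]
  exact h.indep.precomp hinj

end Noise

end LAD2D

theorem theorem3_general {Ω : Type*} [MeasurableSpace Ω] (P : Measure Ω) [IsProbabilityMeasure P]
    (p : ℕ) (Θ : Set (LAD2D.Param p)) (hΘ : IsCompact Θ)
    (hfreq : ∀ θ ∈ Θ, ∀ k, (θ k).2.2 ∈ LAD2D.freqSquare)
    (θ₀ : LAD2D.Param p) (hθ₀ : θ₀ ∈ Θ) (hfreq₀ : ∀ k, (θ₀ k).2.2 ∈ LAD2D.regularFreq)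
    (hcomp : LAD2D.HasGenuineComponents θ₀)
    (ε : ℕ → ℕ → Ω → ℝ) (μ : Measure ℝ) (hμ : LAD2D.IsUniqueMedianZero μ)
    (hindep : iIndepFun (fun i : Set.Ici (1 : ℕ × ℕ) => ε i.1.1 i.1.2) P)
    (hlaw : ∀ t s, 1 ≤ t → 1 ≤ s → HasLaw (ε t s) μ P)
    (y : ℕ → ℕ → Ω → ℝ)
    (hy : ∀ t s, 1 ≤ t → 1 ≤ s → ∀ ω, y t s ω = LAD2D.signal θ₀ t s + ε t s ω)
    (θhat : ℕ → ℕ → Ω → LAD2D.Param p) (hθhat : LAD2D.IsLADEstimator Θ y θhat) :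
    ∀ᵐ ω ∂P, ∃ σ : ℕ → ℕ → Equiv.Perm (Fin p),
      Tendsto (fun n : ℕ × ℕ => fun k : Fin p => θhat n.1 n.2 ω (σ n.1 n.2 k))
        (comap (fun n : ℕ × ℕ => min n.1 n.2) atTop) (𝓝 θ₀) := by
  rw [LAD2D.comap_min_atTop]
  have hprob : IsProbabilityMeasure μ :=
    (hlaw 1 1 le_rfl le_rfl).isProbabilityMeasure_iff.1 inferInstance
  obtain ⟨R, hR, hΘR⟩ := hΘ.isBounded.subset_closedBall_lt 0 0
  filter_upwards [LAD2D.ae_tendstoUniformlyOn_gainFluctuation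
    (ε := fun i => ε i.1 i.2) hindep (fun i hi => hlaw i.1 i.2 hi.1 hi.2) θ₀ hR.le] with ω hω
  have hmem : ∀ n : ℕ × ℕ, n ≥ 1 → θhat n.1 n.2 ω ∈ Θ := fun n hn => (hθhat n.1 n.2 hn.1 hn.2 ω).1
  have hobjective := LAD2D.tendsto_objective_signal (y := fun t s => y t s ω) hμ
    (fun i hi => hy i.1 i.2 hi.1 hi.2 ω) (hω.mono hΘR) hmem
    fun n hn => (hθhat n.1 n.2 hn.1 hn.2 ω).2 θ₀ hθ₀
  obtain ⟨σ, hσ⟩ := LAD2D.exists_perm_tendsto tendsto_id hΘ hfreq hcomp hfreq₀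
    ((eventually_ge_atTop 1).mono hmem) hobjective
  exact ⟨fun T S => σ (T, S), hσ⟩

theorem theorem3 {Ω : Type*} [MeasurableSpace Ω] (P : Measure Ω) [IsProbabilityMeasure P]
    (p : ℕ) (K : Set ℝ) (hK : IsCompact K)
    (θ₀ : LAD2D.Param p) (hθ₀ : θ₀ ∈ interior (LAD2D.paramSpace p K))
    (hcomp : LAD2D.HasGenuineComponents θ₀)
    (ε : ℕ → ℕ → Ω → ℝ) (G g : ℝ → ℝ) (hε : LAD2D.NoiseAssumption P ε G g)
    (y : ℕ → ℕ → Ω → ℝ)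
    (hy : ∀ t s, 1 ≤ t → 1 ≤ s → ∀ ω, y t s ω = LAD2D.signal θ₀ t s + ε t s ω)
    (θhat : ℕ → ℕ → Ω → LAD2D.Param p)
    (hθhat : LAD2D.IsLADEstimator (LAD2D.paramSpace p K) y θhat) :
    ∀ᵐ ω ∂P, ∃ σ : ℕ → ℕ → Equiv.Perm (Fin p),
      Tendsto (fun n : ℕ × ℕ => fun k : Fin p => θhat n.1 n.2 ω (σ n.1 n.2 k))
        (comap (fun n : ℕ × ℕ => min n.1 n.2) atTop) (𝓝 θ₀) := by
  exact theorem3_general P p _ (LAD2D.isCompact_paramSpace hK)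
    (fun _ => LAD2D.mem_freqSquare_of_mem_paramSpace) θ₀ (interior_subset hθ₀)
    (LAD2D.mem_regularFreq_of_mem_interior_paramSpace hθ₀) hcomp ε _ hε.isUniqueMedianZero
    hε.iIndepFun_Ici (fun _ _ => hε.hasLaw) y hy θhat hθhat
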